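/- **Theorem 1.** Let $n,p,k,z\in\mathbb N$ with $n$ and $z$ even and $1\le z\le n-1$, let $\sigma>0$, let $q=(q_1,\dots,q_p)\in(0,1]^p$, and let $\mu^{(1)},\mu^{(2)}\in\mathbb R^p$ be such that $\theta:=\mu^{(2)}-\mu^{(1)}\ne 0$ has at most $k$ non-zero coordinates. Put $\tau:=n^{-1}\min(z,n-z)$ and $\|\theta\|_{2,q}:=\bigl(\sum_{j=1}^p\theta_j^2q_j\bigr)^{1/2}$. *Model.* Let $X=(X_{j,t})\in\mathbb R^{p\times n}$ have independent columns $X_t\sim N_p(\mu_t,\sigma^2I_p)$, where $\mu_t=\mu^{(1)}$ for $t\le z$ and $\mu_t=\mu^{(2)}$ for $t>z$. Independently of $X$, let $\Omega=(\omega_{j,t})\in\{0,1\}^{p\times n}$ have independent entries with $\omega_{j,t}\sim\mathrm{Bern}(q_j)$. The entrywise product is written $X\circ\Omega$. *MissCUSUM transformation.* For $M\in\mathbb R^{p\times m}$ and $\Omega\in\{0,1\}^{p\times m}$ write $L_{j,t}:=\sum_{r=1}^t\omega_{j,r}$, $R_{j,t}:=\sum_{r=m-t+1}^m\omega_{j,r}$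 and $N_j:=L_{j,m}$. Then $\mathcal T^{\mathrm{Miss}}(M,\Omega)\in\mathbb R^{p\times(m-1)}$ has $(j,t)$ entry $$\sqrt{\frac{L_{j,t}R_{j,m-t}}{N_j}}\Bigl(\frac1{R_{j,m-t}}\sum_{r=t+1}^m(M\circ\Omega)_{j,r}-\frac1{L_{j,t}}\sum_{r=1}^t(M\circ\Omega)_{j,r}\Bigr)$$ if $L_{j,t}>0$ and $R_{j,m-t}>0$, and $0$ otherwise. *Estimator.* Let $n_1:=n/2$ and $\lambda:=2\sigma\sqrt{n\log(pn)}$. Let $T^{(1)}$ and $T^{(2)}$ in $\mathbb R^{p\times(n_1-1)}$ be the MissCUSUM transformations of the pairs formed by the odd-numbered and by the even-numbered columns of $(X\circ\Omega,\Omega)$, respectively. Let $(\hat v,\hat w)$ be a maximiser of $$(v,w)\mapsto\langle T^{(1)},vw^\top\rangle-\lambda\|v\|_1$$ over $\|v\|_2\le1$, $\|w\|_2\le1$ ($v\in\mathbb R^p$, $w\in\mathbb R^{n_1-1}$), chosen as a function of $T^{(1)}$ so that $\hat v$ is a measurable function of $T^{(1)}$. Finally let $$\hat z:=2\,\mathrm{median}\Bigl(\operatorname*{argmax}_{1\le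 t\le n_1-1}\bigl|(\hat v^\top T^{(2)})_t\bigr|\Bigr),$$ where the median of a finite set of even size is the average of its two middle elements. *Claim.* There exist universal constants $C,C'>0$ (not depending on $n,p,k,z,\mu^{(1)},\mu^{(2)},\sigma,q$ or on the choice of maximiser) such that whenever $$\frac{C'}{\tau}\sqrt{\frac{\log(pn)}n}\Bigl(\frac{\sigma\sqrt k}{\|\theta\|_{2,q}}+\frac{\|\theta\|_2}{\|\theta\|_{2,q}}\Bigr)\le\frac12,$$ we have $$\mathbb P\Bigl\{\frac{|\hat z-z|}{n\tau}>C\sqrt{\frac{\log(kn)}{n\tau}}\Bigl(\frac{\sigma}{\|\theta\|_{2,q}}+\frac{\|\theta\|_2}{\|\theta\|_{2,q}}\Bigr)\Bigr\}\le\frac{22}n.$$ -/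

import Mathlib

open MeasureTheory ProbabilityTheory

noncomputable section

namespace MissInspect

/-! Time points `1, …, n` are represented by `Fin n`: the element `r : Fin n` is time `r + 1`.
Likewise the column `i : Fin (n - 1)` of a CUSUM matrix is the one for the split after `t = i + 1`.
A revelation matrix has entries in `Bool`, with `true` for an observed entry. -/

/-! ### The data-generating mechanism -/

/-- The mean matrix: column `r` is `μ₁` for times `≤ z` and `μ₂` for times `> z`. -/
def meanMatrix {p : ℕ} (n z : ℕ) (μ₁ μ₂ : EuclideanSpace ℝ (Fin p)) :
    Fin p → Fin n → ℝ :=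
  fun j r => if r.val + 1 ≤ z then μ₁ j else μ₂ j

/-- The joint law of the data matrix and the revelation matrix: the two are independent, the
columns of the data matrix are independent `N(mean, σ² I)`, and the entries of the revelation
matrix are independent, those in row `j` being Bernoulli with parameter `q j`. -/
def changepointLaw {p : ℕ} (n z : ℕ) (μ₁ μ₂ : EuclideanSpace ℝ (Fin p)) (σ : ℝ)
    (q : Fin p → unitInterval) : Measure ((Fin p → Fin n → ℝ) × (Fin p → Fin n → Bool)) :=
  (Measure.pi fun j => Measure.pi fun r =>
      gaussianReal (meanMatrix n z μ₁ μ₂ j r) (Real.toNNReal (σ ^ 2))).prod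
    (Measure.pi fun j => Measure.pi fun _ => bernoulliMeasure true false (q j))

/-- The number of coordinates in which the vector `u` is non-zero. -/
def sparsity {p : ℕ} (u : EuclideanSpace ℝ (Fin p)) : ℕ :=
  (Finset.univ.filter fun j => u j ≠ 0).card

/-- The weighted Euclidean norm `(∑ j, u_j² q_j)^{1/2}`. -/
def weightedNorm {p : ℕ} (q : Fin p → unitInterval) (u : EuclideanSpace ℝ (Fin p)) : ℝ :=
  Real.sqrt (∑ j, u j ^ 2 * (q j : ℝ))

/-- The relative distance `τ = n⁻¹ min(z, n - z)` of the changepoint to the boundary. -/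
def boundaryDist (n z : ℕ) : ℝ := min (z : ℝ) ((n : ℝ) - z) / n

/-! ### The MissCUSUM transformation -/

/-- The entrywise product of a data matrix with a revelation matrix. -/
def mask {p n : ℕ} (M : Fin p → Fin n → ℝ) (W : Fin p → Fin n → Bool) : Fin p → Fin n → ℝ :=
  fun j r => if W j r then M j r else 0

/-- The number of observations in row `j` among the first `t` time points. -/
def leftCount {p n : ℕ} (W : Fin p → Fin n → Bool) (j : Fin p) (t : ℕ) : ℕ :=
  (Finset.univ.filter fun r : Fin n => r.val + 1 ≤ t ∧ W j r).card

/-- The number of observations in row `j` among the last `t` time points. -/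
def rightCount {p n : ℕ} (W : Fin p → Fin n → Bool) (j : Fin p) (t : ℕ) : ℕ :=
  (Finset.univ.filter fun r : Fin n => n + 1 ≤ r.val + 1 + t ∧ W j r).card

/-- The entry of the MissCUSUM transformation in row `j` for the split after time `t`. -/
def missCusumAt {p n : ℕ} (M : Fin p → Fin n → ℝ) (W : Fin p → Fin n → Bool)
    (j : Fin p) (t : ℕ) : ℝ :=
  if 0 < leftCount W j t ∧ 0 < rightCount W j (n - t) then
    Real.sqrt ((leftCount W j t : ℝ) * rightCount W j (n - t) / leftCount W j n) *
      (1 / (rightCount W j (n - t) : ℝ) *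
          (∑ r ∈ Finset.univ.filter fun r : Fin n => t + 1 ≤ r.val + 1, mask M W j r) -
        1 / (leftCount W j t : ℝ) *
          (∑ r ∈ Finset.univ.filter fun r : Fin n => r.val + 1 ≤ t, mask M W j r))
  else 0

/-- The MissCUSUM transformation. -/
def missCusum {p n : ℕ} (M : Fin p → Fin n → ℝ) (W : Fin p → Fin n → Bool) :
    Fin p → Fin (n - 1) → ℝ :=
  fun j i => missCusumAt M W j (i.val + 1)

/-! ### The sample-splitting algorithm -/

/-- The first `⌊n / 2⌋` odd-numbered columns (times `1, 3, 5, …`). -/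
def oddColumns {α : Type*} {p n : ℕ} (M : Fin p → Fin n → α) : Fin p → Fin (n / 2) → α :=
  fun j i => M j ⟨2 * i.val, by omega⟩

/-- The `⌊n / 2⌋` even-numbered columns (times `2, 4, 6, …`). -/
def evenColumns {α : Type*} {p n : ℕ} (M : Fin p → Fin n → α) : Fin p → Fin (n / 2) → α :=
  fun j i => M j ⟨2 * i.val + 1, by omega⟩

/-- The penalised objective `⟨T, v wᵀ⟩ - lam * ‖v‖₁` at the pair `(v, w)`. -/
def objective {p m : ℕ} (lam : ℝ) (T : Fin p → Fin m → ℝ)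
    (vw : EuclideanSpace ℝ (Fin p) × EuclideanSpace ℝ (Fin m)) : ℝ :=
  (∑ j, ∑ i, T j i * (vw.1 j * vw.2 i)) - lam * ∑ j, |vw.1 j|

/-- The set of maximisers of the objective over pairs of vectors in the closed unit balls. -/
def argmaxSet {p m : ℕ} (lam : ℝ) (T : Fin p → Fin m → ℝ) :
    Set (EuclideanSpace ℝ (Fin p) × EuclideanSpace ℝ (Fin m)) :=
  {vw | vw ∈ Metric.closedBall 0 1 ×ˢ Metric.closedBall 0 1 ∧
    IsMaxOn (objective lam T) (Metric.closedBall 0 1 ×ˢ Metric.closedBall 0 1) vw}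

/-- The projected series `vᵀ T`. -/
def project {p m : ℕ} (v : EuclideanSpace ℝ (Fin p)) (T : Fin p → Fin m → ℝ) : Fin m → ℝ :=
  fun i => ∑ j, v j * T j i

/-- The set of locations `t ∈ {1, …, m}` at which a series is largest in absolute value. -/
def peakSet {m : ℕ} (f : Fin m → ℝ) : Finset ℕ :=
  (Finset.univ.filter fun i => ∀ i', |f i'| ≤ |f i|).image fun i => i.val + 1

/-- The median of a non-empty finite set: the average of the two middle elements, which coincide
when the number of elements is odd. -/
def median (s : Finset ℕ) : ℝ :=
  (((s.sort).getD ((s.card - 1) / 2) 0 : ℝ) + ((s.sort).getD (s.card / 2) 0 : ℝ)) / 2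

/-- The output of the sample-splitting algorithm on the masked data `Y` and the revelation
matrix `W`, when the optimisation problem for the matrix `T` is solved by the pair `opt T`. -/
def splitEstimator {p n : ℕ}
    (opt : (Fin p → Fin (n / 2 - 1) → ℝ) →
      EuclideanSpace ℝ (Fin p) × EuclideanSpace ℝ (Fin (n / 2 - 1)))
    (Y : Fin p → Fin n → ℝ) (W : Fin p → Fin n → Bool) : ℝ :=
  2 * median (peakSet (project (opt (missCusum (oddColumns Y) (oddColumns W))).1
    (missCusum (evenColumns Y) (evenColumns W))))

end MissInspect

end

/-! Replacing the observation counts by their expectations turns the MissCUSUM transformation of the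
mean matrix into the rank-one matrix with entries `θ_j √q_j γ_t`, where `γ` is the deterministic
CUSUM curve, which peaks at the changepoint with a quantified drop around it. Each square-root count
deviates from its expectation by `O(√log)`, uniformly in `q`, which costs `O(√log) |θ_j|` in row
`j`. Since the noise is standardised by the counts, each entry is Gaussian with standard deviation
at most `σ`, so the penalty `λ` dominates it and `v̂` makes an angle bounded away from `π / 2` with
the direction `(θ_j √q_j)_j`. The even columns are independent of `v̂`: given `v̂`, each entry of
`v̂ᵀT⁽²⁾` is a multiple, of order `‖θ‖_{2,q}`, of `γ_t` plus an error of order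
`√log (σ + ‖θ‖)`, and the drop of `γ` around its peak bounds the distance from the changepoint to
every maximiser, hence to their median. -/

namespace MissInspect

/-- The bijection `Fin (n / 2) ⊕ Fin (n / 2) ≃ Fin n`, for even `n`, that makes the two copies of
`Fin (n / 2)` the odd-numbered and the even-numbered time points. It identifies a row of a matrix
with the pair of its rows in the two half samples. -/
noncomputable def interleave {n : ℕ} (hn : Even n) : Fin (n / 2) ⊕ Fin (n / 2) ≃ Fin n :=
  Equiv.ofBijective
    (Sum.elim (fun i => (⟨2 * i.val, by omega⟩ : Fin n)) fun i => ⟨2 * i.val + 1, by omega⟩) <| by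
    have h_half : n % 2 = 0 := Nat.even_iff.mp hn
    constructor
    · rintro (a | a) (b | b) h <;> simp [Fin.ext_iff] at h ⊢ <;> omega
    · intro r
      obtain h | h := Nat.mod_two_eq_zero_or_one r.val
      · exact ⟨Sum.inl ⟨r.val / 2, by omega⟩, Fin.ext (by simp; omega)⟩
      · exact ⟨Sum.inr ⟨r.val / 2, by omega⟩, Fin.ext (by simp; omega)⟩

section Splitting

variable {α : Type*} [MeasurableSpace α] {p n : ℕ}

theorem measurePreserving_splitRow (hn : Even n) (ν : Fin n → Measure α)
    [∀ r, SigmaFinite (ν r)] :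
    MeasurePreserving
      (fun x : Fin n → α => ((fun i : Fin (n / 2) => x ⟨2 * i.val, by omega⟩),
        fun i : Fin (n / 2) => x ⟨2 * i.val + 1, by omega⟩))
      (Measure.pi ν)
      ((Measure.pi fun i : Fin (n / 2) => ν ⟨2 * i.val, by omega⟩).prod
        (Measure.pi fun i : Fin (n / 2) => ν ⟨2 * i.val + 1, by omega⟩)) :=
  (measurePreserving_sumPiEquivProdPi (X := fun _ : Fin (n / 2) ⊕ Fin (n / 2) => α)
    fun i => ν (interleave hn i)).comp
    (measurePreserving_piCongrLeft (α := fun _ : Fin n => α) ν (interleave hn)).symm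

theorem measurePreserving_oddColumns_evenColumns (hn : Even n) (ν : Fin p → Fin n → Measure α)
    [∀ j r, SigmaFinite (ν j r)] :
    MeasurePreserving (fun x : Fin p → Fin n → α => (oddColumns x, evenColumns x))
      (Measure.pi fun j => Measure.pi (ν j))
      ((Measure.pi fun j => Measure.pi (oddColumns ν j)).prod
        (Measure.pi fun j => Measure.pi (evenColumns ν j))) :=
  (measurePreserving_arrowProdEquivProdArrow (Fin (n / 2) → α) (Fin (n / 2) → α) (Fin p)
    (fun j => Measure.pi fun i : Fin (n / 2) => ν j ⟨2 * i.val, by omega⟩)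
    (fun j => Measure.pi fun i : Fin (n / 2) => ν j ⟨2 * i.val + 1, by omega⟩)).comp
    (measurePreserving_pi _ _ fun j => measurePreserving_splitRow hn (ν j))

end Splitting

section Slicing

variable {α β : Type*} [MeasurableSpace α] [MeasurableSpace β] {s : Set (α × β)} {c : ENNReal}

theorem prod_apply_le_of_forall_fst (μ : Measure α) [IsProbabilityMeasure μ] (ν : Measure β)
    [SFinite ν] (hs : MeasurableSet s) (h : ∀ a, ν {b | (a, b) ∈ s} ≤ c) : μ.prod ν s ≤ c :=
  calc μ.prod ν s = ∫⁻ a, ν (Prod.mk a ⁻¹' s) ∂μ := Measure.prod_apply hs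
    _ ≤ ∫⁻ _, c ∂μ := lintegral_mono h
    _ = c := by simp

theorem prod_apply_le_of_forall_snd (μ : Measure α) [SFinite μ] (ν : Measure β)
    [IsProbabilityMeasure ν] (hs : MeasurableSet s) (h : ∀ b, μ {a | (a, b) ∈ s} ≤ c) :
    μ.prod ν s ≤ c :=
  calc μ.prod ν s = ∫⁻ b, μ ((fun a => (a, b)) ⁻¹' s) ∂ν := Measure.prod_apply_symm hs
    _ ≤ ∫⁻ _, c ∂ν := lintegral_mono h
    _ = c := by simp

end Slicing

section Gaussian

open scoped NNReal

theorem hasSubgaussianMGF_sub_gaussianReal (a : ℝ) (v : ℝ≥0) :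
    HasSubgaussianMGF (fun x => x - a) v (gaussianReal a v) := by
  have h_exp (t : ℝ) : (fun x => Real.exp (t * (x - a))) =
      fun x => Real.exp (-(t * a)) * Real.exp (t * x) := by
    ext x; rw [← Real.exp_add]; ring_nf
  refine ⟨fun t => ?_, fun t => le_of_eq ?_⟩
  · rw [h_exp]
    exact (integrable_exp_mul_gaussianReal t).const_mul _
  · have h_mgf := congrFun (mgf_fun_id_gaussianReal (μ := a) (v := v)) t
    rw [mgf] at h_mgf ⊢
    rw [h_exp, integral_const_mul, h_mgf, ← Real.exp_add]
    ring_nf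

theorem hasSubgaussianMGF_sum_pi {ι : Type*} [Fintype ι] {Ω : ι → Type*}
    [∀ i, MeasurableSpace (Ω i)] {μ : ∀ i, Measure (Ω i)} [∀ i, IsProbabilityMeasure (μ i)]
    {f : ∀ i, Ω i → ℝ} {c : ι → ℝ≥0} (hf : ∀ i, HasSubgaussianMGF (f i) (c i) (μ i)) :
    HasSubgaussianMGF (fun x : ∀ i, Ω i => ∑ i, f i (x i)) (∑ i, c i) (Measure.pi μ) := by
  refine HasSubgaussianMGF.sum_of_iIndepFun (iIndepFun_pi fun i => (hf i).aemeasurable)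
    fun i _ => ?_
  have h_eval := measurePreserving_eval μ i
  exact HasSubgaussianMGF.of_map h_eval.measurable.aemeasurable (h_eval.map_eq.symm ▸ hf i)

theorem hasSubgaussianMGF_mono {Ω : Type*} [MeasurableSpace Ω] {μ : Measure Ω} {X : Ω → ℝ}
    {c d : ℝ≥0} (hX : HasSubgaussianMGF X c μ) (hcd : c ≤ d) : HasSubgaussianMGF X d μ :=
  ⟨hX.integrable_exp_mul, fun t => (hX.mgf_le t).trans (by gcongr)⟩

theorem hasSubgaussianMGF_linear_gaussian {ι κ : Type*} [Fintype ι] [Fintype κ]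
    (a : ι → κ → ℝ) {c : ι → κ → ℝ} (hc : ∑ j, ∑ r, c j r ^ 2 ≤ 1) (v : ℝ≥0) :
    HasSubgaussianMGF (fun x : ι → κ → ℝ => ∑ j, ∑ r, c j r * (x j r - a j r)) v
      (Measure.pi fun j => Measure.pi fun r => gaussianReal (a j r) v) := by
  have h_sum := hasSubgaussianMGF_sum_pi (f := fun j (y : κ → ℝ) => ∑ r, c j r * (y r - a j r))
    fun j => hasSubgaussianMGF_sum_pi (f := fun r (y : ℝ) => c j r * (y - a j r)) fun r =>
      (hasSubgaussianMGF_sub_gaussianReal (a j r) v).const_mul (c j r)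
  refine hasSubgaussianMGF_mono h_sum (NNReal.coe_le_coe.mp ?_)
  calc _ = (∑ j, ∑ r, c j r ^ 2) * (v : ℝ) := by
        simp only [NNReal.coe_sum, Finset.sum_mul]; rfl
    _ ≤ v := mul_le_of_le_one_left v.coe_nonneg hc

theorem measure_lt_abs_le_of_hasSubgaussianMGF {Ω : Type*} [MeasurableSpace Ω] {μ : Measure Ω}
    [IsFiniteMeasure μ] {X : Ω → ℝ} {c : ℝ≥0} (hX : HasSubgaussianMGF X c μ) {ε : ℝ}
    (hε : 0 ≤ ε) :
    μ {ω | ε < |X ω|} ≤ ENNReal.ofReal (2 * Real.exp (-ε ^ 2 / (2 * c))) := by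
  have h_sub : {ω | ε < |X ω|} ⊆ {ω | ε ≤ X ω} ∪ {ω | ε ≤ (-X) ω} := by
    intro ω (hω : ε < |X ω|)
    exact (lt_abs.mp hω).imp (fun h : ε < X ω => h.le) fun h : ε < -X ω => h.le
  rw [← ofReal_measureReal]
  refine ENNReal.ofReal_le_ofReal ?_
  calc μ.real {ω | ε < |X ω|} ≤ μ.real {ω | ε ≤ X ω} + μ.real {ω | ε ≤ (-X) ω} :=
        (measureReal_mono h_sub).trans (measureReal_union_le _ _)
    _ ≤ Real.exp (-ε ^ 2 / (2 * c)) + Real.exp (-ε ^ 2 / (2 * c)) :=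
        add_le_add (hX.measure_ge_le hε) (hX.neg.measure_ge_le hε)
    _ = 2 * Real.exp (-ε ^ 2 / (2 * c)) := by ring

theorem gaussian_linear_tail {ι κ : Type*} [Fintype ι] [Fintype κ] (a : ι → κ → ℝ)
    {c : ι → κ → ℝ} {σ y : ℝ} (hσ : 0 < σ) (hy : 0 ≤ y) (hc : ∑ j, ∑ r, c j r ^ 2 ≤ 1) :
    (Measure.pi fun j => Measure.pi fun r => gaussianReal (a j r) (Real.toNNReal (σ ^ 2)))
        {x | σ * y < |∑ j, ∑ r, c j r * (x j r - a j r)|} ≤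
      ENNReal.ofReal (2 * Real.exp (-(y ^ 2 / 2))) := by
  have h_tail := measure_lt_abs_le_of_hasSubgaussianMGF
    (hasSubgaussianMGF_linear_gaussian a hc (Real.toNNReal (σ ^ 2))) (mul_nonneg hσ.le hy)
  have h_exponent : -(σ * y) ^ 2 / (2 * (Real.toNNReal (σ ^ 2) : ℝ)) = -(y ^ 2 / 2) := by
    rw [Real.coe_toNNReal _ (sq_nonneg σ)]
    field_simp
  rwa [h_exponent] at h_tail

end Gaussian

section SuccessCount

variable {ι : Type*} [Fintype ι] (q : unitInterval) (S : Finset ι)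

theorem mgf_card_filter_le (s : ℝ) :
    mgf (fun w : ι → Bool => ((S.filter fun r => w r).card : ℝ))
        (Measure.pi fun _ => bernoulliMeasure true false q) s ≤
      Real.exp (q * S.card * (Real.exp s - 1)) := by
  classical
  have h_factor (w : ι → Bool) : Real.exp (s * (S.filter fun r => w r).card) =
      ∏ r, if r ∈ S then Real.exp (if w r then s else 0) else 1 := by
    rw [Finset.prod_ite_mem, Finset.univ_inter, ← Real.exp_sum, ← Finset.sum_filter,
      Finset.sum_const, nsmul_eq_mul, mul_comm]
  have h_integral (r : ι) : ∫ b : Bool, (if r ∈ S then Real.exp (if b then s else 0) else 1)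
      ∂(bernoulliMeasure true false q) = if r ∈ S then 1 + q * (Real.exp s - 1) else 1 := by
    split_ifs
    · simp [integral_bernoulliMeasure]
      ring
    · simp
  calc mgf (fun w : ι → Bool => ((S.filter fun r => w r).card : ℝ))
        (Measure.pi fun _ => bernoulliMeasure true false q) s
      = (1 + q * (Real.exp s - 1)) ^ S.card := by
        simp only [mgf, h_factor]
        rw [integral_fintype_prod_eq_prod
          (fun r (b : Bool) => if r ∈ S then Real.exp (if b then s else 0) else 1),
          Finset.prod_congr rfl fun r _ => h_integral r, Finset.prod_ite_mem, Finset.univ_inter,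
          Finset.prod_const]
    _ ≤ Real.exp (q * (Real.exp s - 1)) ^ S.card := by
        refine pow_le_pow_left₀ ?_ ?_ _
        · nlinarith [Real.exp_pos s, q.2.1, q.2.2]
        · linarith [Real.add_one_le_exp ((q : ℝ) * (Real.exp s - 1))]
    _ = Real.exp (q * S.card * (Real.exp s - 1)) := by
        rw [← Real.exp_nat_mul]; ring_nf

/-- With this choice of the exponent, Chernoff's bound for a Poisson variable of mean `c²` at the
level `b²` turns into a bound for the deviation of its square root. -/
theorem poisson_rate_le_neg_sq_sub {b c : ℝ} (hb : 0 < b) (hc : 0 < c) :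
    -(2 * Real.log (b / c)) * b ^ 2 + c ^ 2 * (Real.exp (2 * Real.log (b / c)) - 1) ≤
      -(b - c) ^ 2 := by
  have h_exp : Real.exp (2 * Real.log (b / c)) = (b / c) ^ 2 := by
    rw [two_mul, Real.exp_add, Real.exp_log (div_pos hb hc), pow_two]
  have h_log : -Real.log (b / c) ≤ c / b - 1 := by
    rw [← Real.log_inv, inv_div]
    exact Real.log_le_sub_one_of_pos (div_pos hc hb)
  calc -(2 * Real.log (b / c)) * b ^ 2 + c ^ 2 * (Real.exp (2 * Real.log (b / c)) - 1)
      = 2 * b ^ 2 * -Real.log (b / c) + (b ^ 2 - c ^ 2) := by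
        rw [h_exp]; field_simp
    _ ≤ 2 * b ^ 2 * (c / b - 1) + (b ^ 2 - c ^ 2) := by gcongr
    _ = -(b - c) ^ 2 := by field_simp; ring

theorem exists_nonneg_poisson_rate_le {c x : ℝ} (hc : 0 ≤ c) (hx : 0 ≤ x) :
    ∃ s, 0 ≤ s ∧ -s * (c + x) ^ 2 + c ^ 2 * (Real.exp s - 1) ≤ -x ^ 2 := by
  obtain rfl | hc := hc.eq_or_lt
  · exact ⟨1, zero_le_one, by simp⟩
  · refine ⟨2 * Real.log ((c + x) / c), ?_, ?_⟩
    · exact mul_nonneg zero_le_two (Real.log_nonneg ((one_le_div hc).mpr (by linarith)))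
    · simpa using poisson_rate_le_neg_sq_sub (by positivity : 0 < c + x) hc

theorem exists_nonpos_poisson_rate_le {c x : ℝ} (hx : 0 ≤ x) (hxc : x < c) :
    ∃ s ≤ 0, -s * (c - x) ^ 2 + c ^ 2 * (Real.exp s - 1) ≤ -x ^ 2 := by
  have hc : 0 < c := hx.trans_lt hxc
  have hcx : 0 < c - x := sub_pos.mpr hxc
  refine ⟨2 * Real.log ((c - x) / c), ?_, ?_⟩
  · exact mul_nonpos_of_nonneg_of_nonpos zero_le_two
      (Real.log_nonpos (by positivity) ((div_le_one hc).mpr (by linarith)))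
  · simpa using poisson_rate_le_neg_sq_sub hcx hc

theorem sqrt_count_upper_tail {x : ℝ} (hx : 0 ≤ x) :
    (Measure.pi fun _ : ι => bernoulliMeasure true false q).real
        {w | √(q * S.card) + x ≤ √((S.filter fun r => w r).card : ℝ)} ≤ Real.exp (-x ^ 2) := by
  obtain ⟨s, hs, h_rate⟩ := exists_nonneg_poisson_rate_le (Real.sqrt_nonneg (q * S.card)) hx
  have h_sub : {w : ι → Bool | √(q * S.card) + x ≤ √((S.filter fun r => w r).card : ℝ)} ⊆
      {w | (√(q * S.card) + x) ^ 2 ≤ ((S.filter fun r => w r).card : ℝ)} := fun w hw =>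
    (Real.le_sqrt (by positivity) (Nat.cast_nonneg _)).mp hw
  refine (measureReal_mono h_sub).trans
    ((measure_ge_le_exp_mul_mgf _ hs Integrable.of_finite).trans ?_)
  grw [mgf_card_filter_le q S s]
  rw [Real.sq_sqrt (mul_nonneg q.2.1 (Nat.cast_nonneg _))] at h_rate
  rwa [← Real.exp_add, Real.exp_le_exp]

theorem sqrt_count_lower_tail {x : ℝ} (hx : 0 ≤ x) :
    (Measure.pi fun _ : ι => bernoulliMeasure true false q).real
        {w | √((S.filter fun r => w r).card : ℝ) < √(q * S.card) - x} ≤ Real.exp (-x ^ 2) := by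
  obtain hxc | hxc := lt_or_ge x √(q * S.card)
  · obtain ⟨s, hs, h_rate⟩ := exists_nonpos_poisson_rate_le hx hxc
    have h_sub : {w : ι → Bool | √((S.filter fun r => w r).card : ℝ) < √(q * S.card) - x} ⊆
        {w | ((S.filter fun r => w r).card : ℝ) ≤ (√(q * S.card) - x) ^ 2} := by
      intro w hw
      exact (Real.sqrt_le_left (by linarith)).mp (le_of_lt hw)
    refine (measureReal_mono h_sub).trans
      ((measure_le_le_exp_mul_mgf _ hs Integrable.of_finite).trans ?_)
    grw [mgf_card_filter_le q S s]
    rw [Real.sq_sqrt (mul_nonneg q.2.1 (Nat.cast_nonneg _))] at h_rate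
    rwa [← Real.exp_add, Real.exp_le_exp]
  · have h_empty : {w : ι → Bool | √((S.filter fun r => w r).card : ℝ) < √(q * S.card) - x} = ∅ :=
      Set.eq_empty_of_forall_notMem fun w hw =>
        (Real.sqrt_nonneg _).not_gt (lt_of_lt_of_le hw (by linarith))
    rw [h_empty, measureReal_empty]
    positivity

theorem sqrt_count_tail {x : ℝ} (hx : 0 ≤ x) :
    (Measure.pi fun _ : ι => bernoulliMeasure true false q)
        {w | x < |√((S.filter fun r => w r).card : ℝ) - √(q * S.card)|} ≤
      ENNReal.ofReal (2 * Real.exp (-x ^ 2)) := by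
  have h_sub : {w : ι → Bool | x < |√((S.filter fun r => w r).card : ℝ) - √(q * S.card)|} ⊆
      {w | √(q * S.card) + x ≤ √((S.filter fun r => w r).card : ℝ)} ∪
        {w | √((S.filter fun r => w r).card : ℝ) < √(q * S.card) - x} := by
    intro w (hw : x < |_|)
    obtain h | h := lt_abs.mp hw
    · exact Or.inl (by rw [Set.mem_ofPred_eq]; linarith)
    · exact Or.inr (by rw [Set.mem_ofPred_eq]; linarith)
  rw [← ofReal_measureReal, two_mul]
  exact ENNReal.ofReal_le_ofReal ((measureReal_mono h_sub).trans ((measureReal_union_le _ _).trans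
    (add_le_add (sqrt_count_upper_tail q S hx) (sqrt_count_lower_tail q S hx))))

end SuccessCount

/-! ### The CUSUM curve of a single change -/

/-- The CUSUM statistic of a unit change that lies on the side of the split point counted by `r`,
where `l`, `ρ`, `r` and `ν` are the square roots of the numbers of observations on the other side
of the split, beyond the change, on the side of the change, and in total. The quotients are `0`
when their denominators vanish, in agreement with the convention for an empty side. -/
noncomputable def cusumShape (l ρ r ν : ℝ) : ℝ := l / ν * (ρ / r * ρ)

theorem cusumShape_smul (c l ρ r ν : ℝ) :
    cusumShape (c * l) (c * ρ) (c * r) (c * ν) = c * cusumShape l ρ r ν := by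
  rcases eq_or_ne c 0 with rfl | hc
  · simp [cusumShape]
  · rw [cusumShape, mul_div_mul_left _ _ hc, mul_div_mul_left _ _ hc, cusumShape]
    ring

theorem cusumShape_nonneg {l ρ r ν : ℝ} (hl : 0 ≤ l) (hr : 0 ≤ r) (hν : 0 ≤ ν) :
    0 ≤ cusumShape l ρ r ν := by
  rw [cusumShape, div_mul_eq_mul_div ρ]
  exact mul_nonneg (div_nonneg hl hν) (div_nonneg (mul_self_nonneg ρ) hr)

theorem abs_div_mul_sub_div_mul_le {a b g a' b' g' x y : ℝ} (ha : 0 ≤ a) (hab : a ≤ b)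
    (hg' : 0 ≤ g') (hgb' : g' ≤ b') (hax : |a - a'| ≤ x) (hbx : |b - b'| ≤ x)
    (hgy : |g - g'| ≤ y) : |a / b * g - a' / b' * g'| ≤ 2 * x + y := by
  have scaled_le {u s c : ℝ} (hu : |u| ≤ 1) (hs : |s| ≤ c) : |u * s| ≤ c := by
    rw [abs_mul]
    exact (mul_le_of_le_one_left (abs_nonneg s) hu).trans hs
  have hu : |a / b| ≤ 1 := by
    rw [abs_of_nonneg (div_nonneg ha (ha.trans hab))]
    exact div_le_one_of_le₀ hab (ha.trans hab)
  have hv : |g' / b'| ≤ 1 := by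
    rw [abs_of_nonneg (div_nonneg hg' (hg'.trans hgb'))]
    exact div_le_one_of_le₀ hgb' (hg'.trans hgb')
  have ha_eq : a / b * b = a := div_mul_cancel_of_imp fun hb => le_antisymm (hb ▸ hab) ha
  have hg_eq : g' / b' * b' = g' := div_mul_cancel_of_imp fun hb => le_antisymm (hb ▸ hgb') hg'
  have hsplit : a / b * g - a' / b' * g' =
      g' / b' * (a / b * (b' - b) + (a - a')) + a / b * (g - g') := by
    linear_combination g' / b' * ha_eq - a / b * hg_eq
  rw [hsplit, two_mul]
  refine (abs_add_le _ _).trans (add_le_add (scaled_le hv ?_) (scaled_le hu hgy))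
  exact (abs_add_le _ _).trans (add_le_add (scaled_le hu (abs_sub_comm b b' ▸ hbx)) hax)

theorem abs_cusumShape_sub_le {l ρ r ν l' ρ' r' ν' x : ℝ} (hl : 0 ≤ l) (hlν : l ≤ ν)
    (hρ : 0 ≤ ρ) (hρr : ρ ≤ r) (hρ' : 0 ≤ ρ') (hρr' : ρ' ≤ r') (hrν' : r' ≤ ν')
    (hlx : |l - l'| ≤ x) (hρx : |ρ - ρ'| ≤ x) (hrx : |r - r'| ≤ x) (hνx : |ν - ν'| ≤ x) :
    |cusumShape l ρ r ν - cusumShape l' ρ' r' ν'| ≤ 5 * x := by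
  have hratio : ρ' / r' ≤ 1 := div_le_one_of_le₀ hρr' (hρ'.trans hρr')
  have hinner : |ρ / r * ρ - ρ' / r' * ρ'| ≤ 2 * x + x :=
    abs_div_mul_sub_div_mul_le hρ hρr hρ' hρr' hρx hrx hρx
  have hle : ρ' / r' * ρ' ≤ ν' :=
    (mul_le_of_le_one_left hρ' hratio).trans (hρr'.trans hrν')
  have hnonneg : 0 ≤ ρ' / r' * ρ' :=
    mul_nonneg (div_nonneg hρ' (hρ'.trans hρr')) hρ'
  exact (abs_div_mul_sub_div_mul_le hl hlν hnonneg hle hlx hνx hinner).trans (by linarith)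

/-- The CUSUM statistic after time `t` of a unit change after time `z`, as a function of the square
roots `L s` and `R s` of the numbers of observations up to and after time `s`, and of the square
root `N` of the total number of observations. -/
noncomputable def cusumProfile (L R : ℕ → ℝ) (N : ℝ) (z t : ℕ) : ℝ :=
  if t ≤ z then cusumShape (L t) (R z) (R t) N else cusumShape (R t) (L z) (L t) N

/-- The monotonicity of the square roots of counts up to and after a time in `{0, …, m}`. -/
structure IsCountProfile (m : ℕ) (L R : ℕ → ℝ) (N : ℝ) : Prop where
  left_nonneg : ∀ t, 0 ≤ L t
  right_nonneg : ∀ t, 0 ≤ R t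
  left_mono : Monotone L
  right_anti : Antitone R
  left_le : L m ≤ N
  right_le : R 0 ≤ N

theorem abs_cusumProfile_sub_le {m : ℕ} {L R L' R' : ℕ → ℝ} {N N' x : ℝ}
    (h : IsCountProfile m L R N) (h' : IsCountProfile m L' R' N')
    (hL : ∀ t ≤ m, |L t - L' t| ≤ x) (hR : ∀ t ≤ m, |R t - R' t| ≤ x) (hN : |N - N'| ≤ x)
    {z t : ℕ} (hz : z ≤ m) (ht : t ≤ m) :
    |cusumProfile L R N z t - cusumProfile L' R' N' z t| ≤ 5 * x := by
  unfold cusumProfile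
  split_ifs with htz
  · exact abs_cusumShape_sub_le (h.left_nonneg t) ((h.left_mono ht).trans h.left_le)
      (h.right_nonneg z) (h.right_anti htz) (h'.right_nonneg z) (h'.right_anti htz)
      ((h'.right_anti t.zero_le).trans h'.right_le) (hL t ht) (hR z hz) (hR t ht) hN
  · have hzt : z ≤ t := (not_le.mp htz).le
    exact abs_cusumShape_sub_le (h.right_nonneg t) ((h.right_anti t.zero_le).trans h.right_le)
      (h.left_nonneg z) (h.left_mono hzt) (h'.left_nonneg z) (h'.left_mono hzt)
      ((h'.left_mono ht).trans h'.left_le) (hR t ht) (hL z hz) (hL t ht) hN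

/-- The CUSUM curve of a unit change after time `z` among `m` fully observed time points. -/
noncomputable def cusumCurve (m z t : ℕ) : ℝ :=
  cusumProfile (fun s => √s) (fun s => √(m - s : ℕ)) √m z t

theorem cusumCurve_of_le {m z t : ℕ} (h : t ≤ z) :
    cusumCurve m z t = cusumShape √t √(m - z : ℕ) √(m - t : ℕ) √m :=
  if_pos h

theorem cusumCurve_of_ge {m z t : ℕ} (h : z ≤ t) :
    cusumCurve m z t = cusumShape √(m - t : ℕ) √z √t √m := by
  rcases h.eq_or_lt with rfl | h
  · have div_mul_self (s : ℝ) : s / s * s = s := div_mul_cancel_of_imp id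
    rw [cusumCurve_of_le le_rfl, cusumShape, cusumShape, div_mul_self, div_mul_self]
    ring
  · exact if_neg h.not_ge

theorem cusumCurve_reflect {m z t : ℕ} (hz : z ≤ m) (ht : t ≤ m) :
    cusumCurve m (m - z) (m - t) = cusumCurve m z t := by
  rcases le_total t z with h | h
  · rw [cusumCurve_of_ge (Nat.sub_le_sub_left h m), cusumCurve_of_le h, Nat.sub_sub_self ht]
  · rw [cusumCurve_of_le (Nat.sub_le_sub_left h m), cusumCurve_of_ge h, Nat.sub_sub_self hz,
      Nat.sub_sub_self ht]

theorem cusumCurve_nonneg (m z t : ℕ) : 0 ≤ cusumCurve m z t := by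
  rcases le_total t z with h | h
  · rw [cusumCurve_of_le h]
    exact cusumShape_nonneg (Real.sqrt_nonneg _) (Real.sqrt_nonneg _) (Real.sqrt_nonneg _)
  · rw [cusumCurve_of_ge h]
    exact cusumShape_nonneg (Real.sqrt_nonneg _) (Real.sqrt_nonneg _) (Real.sqrt_nonneg _)

theorem cusumCurve_sq_of_le {m z t : ℕ} (h : t ≤ z) :
    cusumCurve m z t ^ 2 = t / m * ((m - z : ℕ) ^ 2 / (m - t : ℕ)) := by
  rw [cusumCurve_of_le h, cusumShape, mul_pow, mul_pow, div_pow, div_pow]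
  simp only [Real.sq_sqrt (Nat.cast_nonneg _)]
  ring

theorem mul_succ_le_cusumCurve_sq {m z i : ℕ} (hzm : z < m) (hi : i < z) :
    ((m - z : ℕ) : ℝ) ^ 2 / m ^ 2 * (i + 1) ≤ cusumCurve m z (i + 1) ^ 2 := by
  have hpos : (0 : ℝ) < (m - (i + 1) : ℕ) := by exact_mod_cast (by omega)
  have hle : ((m - (i + 1) : ℕ) : ℝ) ≤ m := by exact_mod_cast Nat.sub_le m (i + 1)
  rw [cusumCurve_sq_of_le hi]
  calc ((m - z : ℕ) : ℝ) ^ 2 / m ^ 2 * (i + 1)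
      = ((i + 1 : ℕ) : ℝ) / m * (((m - z : ℕ) : ℝ) ^ 2 / m) := by push_cast; ring
    _ ≤ ((i + 1 : ℕ) : ℝ) / m * (((m - z : ℕ) : ℝ) ^ 2 / (m - (i + 1) : ℕ)) := by gcongr

theorem sum_range_succ_cast (z : ℕ) : ∑ i ∈ Finset.range z, ((i : ℝ) + 1) = z * (z + 1) / 2 := by
  induction z with
  | zero => simp
  | succ k ih => rw [Finset.sum_range_succ, ih]; push_cast; ring

theorem sum_cusumCurve_sq_of_le {m z : ℕ} (hzm : z < m) (hm : m ≤ 2 * z) :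
    ((m - z : ℕ) : ℝ) ^ 2 / 8 ≤ ∑ i ∈ Finset.range (m - 1), cusumCurve m z (i + 1) ^ 2 := by
  have hm0 : (0 : ℝ) < m := by exact_mod_cast (by omega : 0 < m)
  have hm2 : (m : ℝ) ≤ 2 * z := by exact_mod_cast hm
  calc ((m - z : ℕ) : ℝ) ^ 2 / 8
      = ((m - z : ℕ) : ℝ) ^ 2 / m ^ 2 * (m ^ 2 / 8) := by field_simp
    _ ≤ ((m - z : ℕ) : ℝ) ^ 2 / m ^ 2 * (z * (z + 1) / 2) :=
        mul_le_mul_of_nonneg_left (by nlinarith) (by positivity)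
    _ = ∑ i ∈ Finset.range z, ((m - z : ℕ) : ℝ) ^ 2 / m ^ 2 * (i + 1) := by
        rw [← Finset.mul_sum, sum_range_succ_cast]
    _ ≤ ∑ i ∈ Finset.range z, cusumCurve m z (i + 1) ^ 2 :=
        Finset.sum_le_sum fun _ hi => mul_succ_le_cusumCurve_sq hzm (Finset.mem_range.mp hi)
    _ ≤ ∑ i ∈ Finset.range (m - 1), cusumCurve m z (i + 1) ^ 2 :=
        Finset.sum_le_sum_of_subset_of_nonneg
          (Finset.range_mono (Nat.le_sub_one_of_lt hzm)) fun _ _ _ => sq_nonneg _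

theorem sum_cusumCurve_sq {m z : ℕ} (hz : 0 < z) (hzm : z < m) :
    ((min z (m - z) : ℕ) : ℝ) ^ 2 / 8 ≤
      ∑ i ∈ Finset.range (m - 1), cusumCurve m z (i + 1) ^ 2 := by
  rcases le_total m (2 * z) with h | h
  · rw [min_eq_right (by omega)]
    exact sum_cusumCurve_sq_of_le hzm h
  · have hreflect : ∀ i ∈ Finset.range (m - 1),
        cusumCurve m z (m - 1 - 1 - i + 1) = cusumCurve m (m - z) (i + 1) := fun i hi => by
      have := Finset.mem_range.mp hi
      rw [← cusumCurve_reflect hzm.le (by omega)]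
      congr 1
      omega
    rw [min_eq_left (by omega), ← Finset.sum_range_reflect,
      Finset.sum_congr rfl fun i hi => by rw [hreflect i hi]]
    conv_lhs => rw [← Nat.sub_sub_self hzm.le]
    exact sum_cusumCurve_sq_of_le (by omega) (by omega)

theorem le_cusumShape_sub {a b c d M D : ℝ} (ha : 0 < a) (hb : 0 < b) (hd : 0 < d)
    (hM : 0 < M) (hM2 : M ^ 2 = a ^ 2 + b ^ 2) (hD : 0 ≤ D) (hc2 : c ^ 2 = a ^ 2 - D)
    (hd2 : d ^ 2 = b ^ 2 + D) :
    b * M * D / (2 * a * d ^ 2) ≤ cusumShape a b b M - cusumShape c b d M := by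
  have hle : b * c ≤ a * d := by
    refine le_of_sq_le_sq ?_ (by positivity)
    rw [mul_pow, mul_pow, hc2, hd2]
    nlinarith [mul_nonneg (sq_nonneg a) hD, mul_nonneg (sq_nonneg b) hD]
  have hdiff : (a * d - b * c) * (a * d + b * c) = M ^ 2 * D := by
    linear_combination a ^ 2 * hd2 - b ^ 2 * hc2 - D * hM2
  have hnum : M ^ 2 * D ≤ (a * d - b * c) * (2 * (a * d)) :=
    hdiff ▸ mul_le_mul_of_nonneg_left (by linarith) (sub_nonneg.mpr hle)
  have hshape : cusumShape a b b M - cusumShape c b d M = b * (a * d - b * c) / (M * d) := by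
    unfold cusumShape
    field_simp
  rw [hshape, div_le_div_iff₀ (by positivity) (by positivity)]
  calc b * M * D * (M * d) = b * d * (M ^ 2 * D) := by ring
    _ ≤ b * d * ((a * d - b * c) * (2 * (a * d))) := by gcongr
    _ = b * (a * d - b * c) * (2 * a * d ^ 2) := by ring

theorem min_div_le_drop {a b M D : ℝ} (ha : 0 < a) (hb : 0 < b) (hM : 0 < M)
    (hM2 : M ^ 2 = a ^ 2 + b ^ 2) (hD : 0 ≤ D) (hDa : D ≤ a ^ 2) :
    min D (min a b ^ 2) / (4 * min a b) ≤ b * M * D / (2 * a * (b ^ 2 + D)) := by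
  rcases le_total a b with hab | hab
  · have hMb : M ≤ 2 * b := by nlinarith
    rw [min_eq_left hab, min_eq_left hDa, div_le_div_iff₀ (by positivity) (by positivity)]
    calc D * (2 * a * (b ^ 2 + D)) ≤ D * (2 * a * (M * M)) := by gcongr; nlinarith
      _ ≤ D * (2 * a * (2 * b * M)) := by gcongr
      _ = b * M * D * (4 * a) := by ring
  · have haM : a ≤ M := by nlinarith
    have hmin : min D (b ^ 2) * (b ^ 2 + D) ≤ 2 * (b ^ 2 * D) := by
      rcases le_total D (b ^ 2) with h | h
      · rw [min_eq_left h]; nlinarith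
      · rw [min_eq_right h]; nlinarith
    rw [min_eq_right hab, div_le_div_iff₀ (by positivity) (by positivity)]
    calc min D (b ^ 2) * (2 * a * (b ^ 2 + D))
        = 2 * a * (min D (b ^ 2) * (b ^ 2 + D)) := by ring
      _ ≤ 2 * M * (2 * (b ^ 2 * D)) := by gcongr
      _ = b * M * D * (4 * b) := by ring

theorem le_cusumCurve_sub_of_le {m z t : ℕ} (hz : 0 < z) (hzm : z < m) (ht : t ≤ z) :
    min ((z - t : ℕ) : ℝ) (min z (m - z) : ℕ) / (4 * √(min z (m - z) : ℕ)) ≤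
      cusumCurve m z z - cusumCurve m z t := by
  have sq_sqrt (k : ℕ) : √(k : ℝ) ^ 2 = k := Real.sq_sqrt k.cast_nonneg
  have sqrt_pos {k : ℕ} (hk : 0 < k) : 0 < √(k : ℝ) := Real.sqrt_pos.mpr (by exact_mod_cast hk)
  have hsqrt_min : √((min z (m - z) : ℕ) : ℝ) = min √z √(m - z : ℕ) := by
    rw [Nat.cast_min, Monotone.map_min fun _ _ => Real.sqrt_le_sqrt]
  have hM2 : √(m : ℝ) ^ 2 = √z ^ 2 + √(m - z : ℕ) ^ 2 := by
    simp only [sq_sqrt]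
    exact_mod_cast (by omega : m = z + (m - z))
  have hd2 : √(m - t : ℕ) ^ 2 = √(m - z : ℕ) ^ 2 + (z - t : ℕ) := by
    simp only [sq_sqrt]
    exact_mod_cast (by omega : m - t = m - z + (z - t))
  have hc2 : √(t : ℝ) ^ 2 = √z ^ 2 - (z - t : ℕ) := by
    simp only [sq_sqrt, Nat.cast_sub ht, sub_sub_cancel]
  have hDz : ((z - t : ℕ) : ℝ) ≤ √z ^ 2 := by
    rw [sq_sqrt]
    exact_mod_cast z.sub_le t
  have ha := sqrt_pos hz
  have hb := sqrt_pos (Nat.sub_pos_of_lt hzm)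
  have hM := sqrt_pos (hz.trans hzm)
  rw [cusumCurve_of_le le_rfl, cusumCurve_of_le ht, hsqrt_min,
    ← sq_sqrt (min z (m - z)), hsqrt_min]
  refine (min_div_le_drop ha hb hM hM2 (Nat.cast_nonneg _) hDz).trans ?_
  rw [← hd2]
  exact le_cusumShape_sub ha hb (sqrt_pos (by omega)) hM hM2 (Nat.cast_nonneg _) hc2 hd2

theorem le_cusumCurve_sub {m z t : ℕ} (hz : 0 < z) (hzm : z < m) (ht : t ≤ m) :
    min |(t : ℝ) - z| (min z (m - z) : ℕ) / (4 * √(min z (m - z) : ℕ)) ≤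
      cusumCurve m z z - cusumCurve m z t := by
  rcases le_total t z with h | h
  · rw [abs_sub_comm, ← Nat.cast_sub h, Nat.abs_cast]
    exact le_cusumCurve_sub_of_le hz hzm h
  · have hleft := le_cusumCurve_sub_of_le (m := m) (z := m - z) (t := m - t)
      (by omega) (by omega) (by omega)
    rwa [cusumCurve_reflect hzm.le hzm.le, cusumCurve_reflect hzm.le ht, Nat.sub_sub_self hzm.le,
      min_comm (m - z), show m - z - (m - t) = t - z by omega, ← Nat.abs_cast, Nat.cast_sub h]
      at hleft

theorem abs_sub_le_of_cusumCurve_sub_le {m z t : ℕ} (hz : 0 < z) (hzm : z < m) (ht : t ≤ m) {δ : ℝ}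
    (hδ : cusumCurve m z z - cusumCurve m z t ≤ δ) (hsmall : δ < √(min z (m - z) : ℕ) / 4) :
    |(t : ℝ) - z| ≤ 4 * √(min z (m - z) : ℕ) * δ := by
  have hκ : 0 < √((min z (m - z) : ℕ) : ℝ) :=
    Real.sqrt_pos.mpr (by exact_mod_cast lt_min hz (Nat.sub_pos_of_lt hzm))
  have hκ2 : √((min z (m - z) : ℕ) : ℝ) ^ 2 = (min z (m - z) : ℕ) :=
    Real.sq_sqrt (Nat.cast_nonneg _)
  have hmin := (le_cusumCurve_sub hz hzm ht).trans hδ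
  rw [div_le_iff₀ (by positivity), mul_comm δ] at hmin
  rcases min_le_iff.mp hmin with h | h
  · linarith
  · nlinarith

/-! ### The MissCUSUM transformation as a linear map -/

section Coefficients

variable {p m : ℕ} (W : Fin p → Fin m → Bool) (j : Fin p)

/-- The weight of the observation at time `r + 1` in the MissCUSUM statistic at time `t`. -/
noncomputable def cusumCoef (t : ℕ) (r : Fin m) : ℝ :=
  √((leftCount W j t : ℝ) * rightCount W j (m - t) / leftCount W j m) *
    ((if ¬ r.val + 1 ≤ t ∧ W j r then 1 / (rightCount W j (m - t) : ℝ) else 0) -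
      if r.val + 1 ≤ t ∧ W j r then 1 / (leftCount W j t : ℝ) else 0)

theorem sum_ite_leftCount (t : ℕ) (c : ℝ) :
    ∑ r : Fin m, (if r.val + 1 ≤ t ∧ W j r then c else 0) = leftCount W j t * c := by
  rw [← Finset.sum_filter, Finset.sum_const, nsmul_eq_mul, leftCount]

theorem sum_ite_rightCount {t : ℕ} (ht : t ≤ m) (c : ℝ) :
    ∑ r : Fin m, (if ¬ r.val + 1 ≤ t ∧ W j r then c else 0) = rightCount W j (m - t) * c := by
  have hiff : ∀ r : Fin m, ¬ r.val + 1 ≤ t ↔ m + 1 ≤ r.val + 1 + (m - t) := by omega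
  simp only [hiff]
  rw [← Finset.sum_filter, Finset.sum_const, nsmul_eq_mul, rightCount]

theorem leftCount_add_rightCount {t : ℕ} (ht : t ≤ m) :
    leftCount W j t + rightCount W j (m - t) = leftCount W j m := by
  have hsum : (leftCount W j t : ℝ) + rightCount W j (m - t) = leftCount W j m := by
    rw [← mul_one (leftCount W j t : ℝ), ← sum_ite_leftCount,
      ← mul_one (rightCount W j (m - t) : ℝ), ← sum_ite_rightCount W j ht,
      ← mul_one (leftCount W j m : ℝ), ← sum_ite_leftCount, ← Finset.sum_add_distrib]
    refine Finset.sum_congr rfl fun r _ => ?_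
    have hr : r.val + 1 ≤ m := r.isLt
    by_cases h : r.val + 1 ≤ t <;> simp [h, hr]
  exact_mod_cast hsum

theorem leftCount_mono : Monotone (leftCount W j) := fun _ _ h =>
  Finset.card_le_card <| Finset.monotone_filter_right _ fun _ _ hr => ⟨hr.1.trans h, hr.2⟩

theorem rightCount_mono : Monotone (rightCount W j) := fun _ _ h =>
  Finset.card_le_card <| Finset.monotone_filter_right _ fun _ _ hr => ⟨by omega, hr.2⟩

theorem missCusumAt_mask (M : Fin p → Fin m → ℝ) (t : ℕ) :
    missCusumAt (mask M W) W j t = ∑ r, cusumCoef W j t r * M j r := by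
  have hgt : ∀ r : Fin m, t + 1 ≤ r.val + 1 ↔ ¬ r.val + 1 ≤ t := by omega
  unfold missCusumAt cusumCoef
  split_ifs with h
  · rw [Finset.mul_sum, Finset.mul_sum, Finset.sum_filter, Finset.sum_filter,
      ← Finset.sum_sub_distrib, Finset.mul_sum]
    refine Finset.sum_congr rfl fun r _ => ?_
    simp only [mask, hgt]
    by_cases hr : r.val + 1 ≤ t <;> cases hw : W j r <;> simp [hr, mul_assoc]
  · have h0 : leftCount W j t = 0 ∨ rightCount W j (m - t) = 0 := by omega
    rcases h0 with h0 | h0 <;> simp [h0]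

theorem sum_cusumCoef_sq_le {t : ℕ} (ht : t ≤ m) : ∑ r, cusumCoef W j t r ^ 2 ≤ 1 := by
  set κ := √((leftCount W j t : ℝ) * rightCount W j (m - t) / leftCount W j m) with hκ
  have hsq : ∀ r, cusumCoef W j t r ^ 2 =
      (if ¬ r.val + 1 ≤ t ∧ W j r then (κ / rightCount W j (m - t)) ^ 2 else 0) +
        if r.val + 1 ≤ t ∧ W j r then (κ / leftCount W j t) ^ 2 else 0 := fun r => by
    rw [cusumCoef]
    by_cases hr : r.val + 1 ≤ t <;> cases hw : W j r <;> simp [hr, hκ, div_eq_mul_inv]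
  have hκ2 : κ ^ 2 = (leftCount W j t : ℝ) * rightCount W j (m - t) / leftCount W j m :=
    Real.sq_sqrt (by positivity)
  rw [Finset.sum_congr rfl fun r _ => hsq r, Finset.sum_add_distrib, sum_ite_rightCount W j ht,
    sum_ite_leftCount, div_pow, div_pow, hκ2, ← leftCount_add_rightCount W j ht, Nat.cast_add]
  rcases (leftCount W j t).eq_zero_or_pos with hL | hL
  · simp [hL]
  rcases (rightCount W j (m - t)).eq_zero_or_pos with hR | hR
  · simp [hR]
  refine le_of_eq ?_
  field_simp

theorem sum_cusumCoef {t : ℕ} (ht : t ≤ m) : ∑ r, cusumCoef W j t r = 0 := by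
  unfold cusumCoef
  rw [← Finset.mul_sum, Finset.sum_sub_distrib, sum_ite_rightCount W j ht, sum_ite_leftCount]
  rcases eq_or_ne (leftCount W j t) 0 with hL | hL
  · simp [hL]
  rcases eq_or_ne (rightCount W j (m - t)) 0 with hR | hR
  · simp [hR]
  rw [mul_one_div_cancel (Nat.cast_ne_zero.mpr hR), mul_one_div_cancel (Nat.cast_ne_zero.mpr hL),
    sub_self, mul_zero]

theorem sqrt_mul_div_div_mul {L R N Z : ℝ} (hL : 0 ≤ L) (hR : 0 ≤ R) (hZ : 0 ≤ Z) :
    √(L * R / N) / R * Z = cusumShape √L √Z √R √N := by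
  rw [cusumShape, div_mul_eq_mul_div √Z, Real.mul_self_sqrt hZ, Real.sqrt_div (mul_nonneg hL hR),
    Real.sqrt_mul hL, mul_div_right_comm, mul_div_assoc, Real.sqrt_div_self]
  ring

theorem sum_cusumCoef_after {z t : ℕ} (htz : t ≤ z) (hz : z ≤ m) :
    ∑ r : Fin m, (if r.val + 1 ≤ z then 0 else cusumCoef W j t r) =
      cusumShape √(leftCount W j t) √(rightCount W j (m - z)) √(rightCount W j (m - t))
        √(leftCount W j m) := by
  rw [← sqrt_mul_div_div_mul (Nat.cast_nonneg _) (Nat.cast_nonneg _) (Nat.cast_nonneg _),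
    mul_comm, ← sum_ite_rightCount W j hz]
  refine Finset.sum_congr rfl fun r _ => ?_
  by_cases hr : r.val + 1 ≤ z
  · simp [hr]
  · have hrt : ¬ r.val + 1 ≤ t := fun h => hr (h.trans htz)
    cases hw : W j r <;> simp [cusumCoef, hr, hrt, hw, div_eq_mul_inv]

theorem sum_cusumCoef_before {z t : ℕ} (hzt : z ≤ t) :
    ∑ r : Fin m, (if r.val + 1 ≤ z then -cusumCoef W j t r else 0) =
      cusumShape √(rightCount W j (m - t)) √(leftCount W j z) √(leftCount W j t)
        √(leftCount W j m) := by
  rw [← sqrt_mul_div_div_mul (Nat.cast_nonneg _) (Nat.cast_nonneg _) (Nat.cast_nonneg _),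
    mul_comm, ← sum_ite_leftCount W j, mul_comm (rightCount W j (m - t) : ℝ)]
  refine Finset.sum_congr rfl fun r _ => ?_
  by_cases hr : r.val + 1 ≤ z
  · have hrt : r.val + 1 ≤ t := hr.trans hzt
    cases hw : W j r <;> simp [cusumCoef, hr, hrt, hw, div_eq_mul_inv]
  · simp [hr]

theorem sum_cusumCoef_mul_meanMatrix {z t : ℕ} (μ₁ μ₂ : EuclideanSpace ℝ (Fin p)) (ht : t ≤ m)
    (hz : z ≤ m) :
    ∑ r, cusumCoef W j t r * meanMatrix m z μ₁ μ₂ j r = (μ₂ j - μ₁ j) *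
      cusumProfile (fun s => √(leftCount W j s)) (fun s => √(rightCount W j (m - s)))
        √(leftCount W j m) z t := by
  have hcentre (c : ℝ) : ∑ r, c * cusumCoef W j t r = 0 := by
    rw [← Finset.mul_sum, sum_cusumCoef W j ht, mul_zero]
  unfold cusumProfile
  split_ifs with htz
  · rw [← sum_cusumCoef_after W j htz hz, Finset.mul_sum, ← sub_eq_zero,
      ← Finset.sum_sub_distrib]
    refine (Finset.sum_congr rfl fun r _ => ?_).trans (hcentre (μ₁ j))
    rw [meanMatrix]
    split_ifs <;> ring
  · rw [← sum_cusumCoef_before W j (not_le.mp htz).le, Finset.mul_sum, ← sub_eq_zero,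
      ← Finset.sum_sub_distrib]
    refine (Finset.sum_congr rfl fun r _ => ?_).trans (hcentre (μ₂ j))
    rw [meanMatrix]
    split_ifs <;> ring

theorem isCountProfile_counts : IsCountProfile m (fun s => √(leftCount W j s))
    (fun s => √(rightCount W j (m - s))) √(leftCount W j m) where
  left_nonneg _ := Real.sqrt_nonneg _
  right_nonneg _ := Real.sqrt_nonneg _
  left_mono _ _ h := Real.sqrt_le_sqrt (Nat.cast_le.mpr (leftCount_mono W j h))
  right_anti _ _ h :=
    Real.sqrt_le_sqrt (Nat.cast_le.mpr (rightCount_mono W j (Nat.sub_le_sub_left h m)))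
  left_le := le_rfl
  right_le := Real.sqrt_le_sqrt <| Nat.cast_le.mpr <|
    (Nat.le_add_left _ _).trans (leftCount_add_rightCount W j m.zero_le).le

end Coefficients

theorem isCountProfile_expected (m : ℕ) (q : ℝ) :
    IsCountProfile m (fun s => √q * √s) (fun s => √q * √(m - s : ℕ)) (√q * √m) where
  left_nonneg _ := by positivity
  right_nonneg _ := by positivity
  left_mono _ _ h := by dsimp only; gcongr
  right_anti _ _ h := by dsimp only; gcongr
  left_le := le_rfl
  right_le := le_rfl

theorem sqrt_mul_cusumCurve (q : ℝ) (m z t : ℕ) :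
    √q * cusumCurve m z t =
      cusumProfile (fun s => √q * √s) (fun s => √q * √(m - s : ℕ)) (√q * √m) z t := by
  unfold cusumCurve cusumProfile
  split_ifs <;> exact (cusumShape_smul _ _ _ _ _).symm

/-- The square roots of the numbers of observations in the initial and final stretches of row `j`
are within `x` of the square roots of their expectations. -/
def CountsClose {p m : ℕ} (q : Fin p → unitInterval) (x : ℝ) (W : Fin p → Fin m → Bool)
    (j : Fin p) : Prop :=
  ∀ t ≤ m, |√(leftCount W j t) - √(q j * t)| ≤ x ∧ |√(rightCount W j t) - √(q j * t)| ≤ x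

theorem abs_cusum_meanMatrix_sub_le {p m z t : ℕ} {q : Fin p → unitInterval} {x : ℝ}
    {W : Fin p → Fin m → Bool} {μ₁ μ₂ : EuclideanSpace ℝ (Fin p)} {j : Fin p}
    (h : (μ₂ - μ₁) j ≠ 0 → CountsClose q x W j) (hz : z ≤ m) (ht : t ≤ m) :
    |∑ r, cusumCoef W j t r * meanMatrix m z μ₁ μ₂ j r -
        (μ₂ - μ₁) j * √(q j : ℝ) * cusumCurve m z t| ≤ |(μ₂ - μ₁) j| * (5 * x) := by
  have hq (t : ℕ) : √(q j * t : ℝ) = √(q j : ℝ) * √t := Real.sqrt_mul (q j).2.1 _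
  rw [sum_cusumCoef_mul_meanMatrix W j μ₁ μ₂ ht hz, ← PiLp.sub_apply, mul_assoc,
    sqrt_mul_cusumCurve, ← mul_sub, abs_mul]
  rcases eq_or_ne ((μ₂ - μ₁) j) 0 with h0 | h0
  · simp only [h0, abs_zero, zero_mul, le_refl]
  refine mul_le_mul_of_nonneg_left ?_ (abs_nonneg _)
  refine abs_cusumProfile_sub_le (isCountProfile_counts W j) (isCountProfile_expected m (q j))
    (fun s hs => ?_) (fun s _ => ?_) ?_ hz ht
  · exact hq s ▸ (h h0 s hs).1
  · exact hq (m - s) ▸ (h h0 (m - s) (m.sub_le s)).2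
  · exact hq m ▸ (h h0 m le_rfl).1

/-! ### The penalised optimisation problem -/

section Bilinear

variable {ι κ : Type*} [Fintype ι] [Fintype κ]

theorem sum_abs_mul_abs_le_norm_mul_norm (u v : EuclideanSpace ℝ ι) :
    ∑ j, |u j| * |v j| ≤ ‖u‖ * ‖v‖ := by
  simpa only [EuclideanSpace.norm_eq, Real.norm_eq_abs] using
    Real.sum_mul_le_sqrt_mul_sqrt Finset.univ (fun j => |u j|) fun j => |v j|

theorem sum_abs_le_sqrt_card_mul_norm (v : EuclideanSpace ℝ ι) {s : Finset ι}
    (hs : ∀ j ∉ s, v j = 0) : ∑ j, |v j| ≤ √s.card * ‖v‖ := by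
  classical
  let indicator : EuclideanSpace ℝ ι := WithLp.toLp 2 fun j => if j ∈ s then 1 else 0
  have hnorm : ‖indicator‖ = √s.card := by simp [indicator, EuclideanSpace.norm_eq]
  have habs (j : ι) : |v j| = |indicator j| * |v j| := by
    by_cases hj : j ∈ s
    · simp [indicator, hj]
    · simp [hs j hj]
  rw [Finset.sum_congr rfl fun j _ => habs j, ← hnorm]
  exact sum_abs_mul_abs_le_norm_mul_norm indicator v

/-- The Frobenius inner product `⟨T, v wᵀ⟩`. -/
def pairing (T : ι → κ → ℝ) (v : EuclideanSpace ℝ ι) (w : EuclideanSpace ℝ κ) : ℝ :=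
  ∑ j, ∑ i, T j i * (v j * w i)

theorem abs_pairing_le {E : ι → κ → ℝ} {b : ι → ℝ} (hE : ∀ j i, |E j i| ≤ b j)
    (v : EuclideanSpace ℝ ι) (w : EuclideanSpace ℝ κ) :
    |pairing E v w| ≤ (∑ j, b j * |v j|) * ∑ i, |w i| := by
  rw [Finset.sum_mul_sum]
  refine (Finset.abs_sum_le_sum_abs _ _).trans (Finset.sum_le_sum fun j _ => ?_)
  refine (Finset.abs_sum_le_sum_abs _ _).trans (Finset.sum_le_sum fun i _ => ?_)
  rw [abs_mul, abs_mul, ← mul_assoc]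
  gcongr
  exact hE j i

theorem pairing_eq_add_rankOne (T A : ι → κ → ℝ) (u v : EuclideanSpace ℝ ι)
    (g w : EuclideanSpace ℝ κ) :
    pairing T v w = pairing (fun j i => T j i - A j i) v w +
      pairing (fun j i => A j i - u j * g i) v w + inner ℝ u v * inner ℝ g w := by
  simp only [PiLp.inner_apply, RCLike.inner_apply, conj_trivial, Finset.sum_mul_sum, pairing,
    ← Finset.sum_add_distrib]
  exact Finset.sum_congr rfl fun j _ => Finset.sum_congr rfl fun i _ => by ring

/-- The entrywise error of `T` is charged to the `ℓ¹` norm of `v`, hence to the penalty, and the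
error of the rank-one approximation to the Euclidean norm of `θ`. -/
theorem abs_pairing_sub_rankOne_le {T A : ι → κ → ℝ} {u θ : EuclideanSpace ℝ ι}
    {g : EuclideanSpace ℝ κ} {η δ : ℝ} (hη : ∀ j i, |T j i - A j i| ≤ η)
    (hA : ∀ j i, |A j i - u j * g i| ≤ |θ j| * δ) (hη0 : 0 ≤ η) (hδ : 0 ≤ δ)
    {v : EuclideanSpace ℝ ι} {w : EuclideanSpace ℝ κ} (hv : ‖v‖ ≤ 1) (hw : ‖w‖ ≤ 1) :
    |pairing T v w - inner ℝ u v * inner ℝ g w| ≤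
      √(Fintype.card κ) * η * ∑ j, |v j| + √(Fintype.card κ) * δ * ‖θ‖ := by
  have hw1 : ∑ i, |w i| ≤ √(Fintype.card κ) :=
    (sum_abs_le_sqrt_card_mul_norm w (s := Finset.univ) fun i hi =>
      absurd (Finset.mem_univ i) hi).trans (mul_le_of_le_one_right (Real.sqrt_nonneg _) hw)
  have hθ : ∑ j, |θ j| * |v j| ≤ ‖θ‖ :=
    (sum_abs_mul_abs_le_norm_mul_norm θ v).trans (mul_le_of_le_one_right (norm_nonneg θ) hv)
  have hnoise : |pairing (fun j i => T j i - A j i) v w| ≤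
      √(Fintype.card κ) * η * ∑ j, |v j| := by
    refine (abs_pairing_le hη v w).trans ?_
    rw [← Finset.mul_sum, mul_comm √_ η, mul_right_comm]
    gcongr
  have hbias : |pairing (fun j i => A j i - u j * g i) v w| ≤ √(Fintype.card κ) * δ * ‖θ‖ := by
    refine (abs_pairing_le hA v w).trans ?_
    rw [Finset.sum_congr rfl fun j _ => mul_right_comm |θ j| δ |v j|, ← Finset.sum_mul,
      mul_comm (_ * δ), mul_assoc, mul_comm δ]
    gcongr
  rw [pairing_eq_add_rankOne T A u v g w, add_sub_cancel_right]
  exact (abs_add_le _ _).trans (add_le_add hnoise hbias)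

end Bilinear

theorem norm_inv_norm_smul_le_one {E : Type*} [NormedAddCommGroup E] [NormedSpace ℝ E] (u : E) :
    ‖‖u‖⁻¹ • u‖ ≤ 1 := by
  rw [norm_smul, norm_inv, norm_norm]
  exact inv_mul_le_one

theorem inner_inv_norm_smul_self {E : Type*} [NormedAddCommGroup E] [InnerProductSpace ℝ E]
    (u : E) : inner ℝ u (‖u‖⁻¹ • u) = ‖u‖ := by
  rw [real_inner_smul_right, real_inner_self_eq_norm_mul_norm, ← mul_assoc, inv_mul_mul_self]

theorem sum_abs_inv_norm_smul_le {p : ℕ} (u : EuclideanSpace ℝ (Fin p)) :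
    ∑ j, |(‖u‖⁻¹ • u) j| ≤ √(sparsity u) := by
  refine (sum_abs_le_sqrt_card_mul_norm (‖u‖⁻¹ • u) (s := Finset.univ.filter fun j => u j ≠ 0)
    fun j hj => ?_).trans (mul_le_of_le_one_right (Real.sqrt_nonneg _)
      (norm_inv_norm_smul_le_one u))
  rw [PiLp.smul_apply, smul_eq_mul, mul_eq_zero]
  exact Or.inr (by simpa using hj)

/-- The maximiser is compared with the normalised pair `(u / ‖u‖, g / ‖g‖)`. -/
theorem le_abs_inner_mul_norm_of_mem_argmaxSet {p k : ℕ} {lam ε : ℝ} {T : Fin p → Fin k → ℝ}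
    {u : EuclideanSpace ℝ (Fin p)} {g : EuclideanSpace ℝ (Fin k)}
    {vw : EuclideanSpace ℝ (Fin p) × EuclideanSpace ℝ (Fin k)} (hvw : vw ∈ argmaxSet lam T)
    (hlam : 0 ≤ lam)
    (hT : ∀ v w, ‖v‖ ≤ 1 → ‖w‖ ≤ 1 →
      |pairing T v w - inner ℝ u v * inner ℝ g w| ≤ lam * ∑ j, |v j| + ε) :
    ‖u‖ * ‖g‖ - 2 * ε - 2 * (lam * √(sparsity u)) ≤ |inner ℝ u vw.1| * ‖g‖ := by
  obtain ⟨hmem, hmax⟩ := hvw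
  have hv : ‖vw.1‖ ≤ 1 := mem_closedBall_zero_iff.mp hmem.1
  have hw : ‖vw.2‖ ≤ 1 := mem_closedBall_zero_iff.mp hmem.2
  have hu1 := norm_inv_norm_smul_le_one u
  have hg1 := norm_inv_norm_smul_le_one g
  have hcompare : objective lam T (‖u‖⁻¹ • u, ‖g‖⁻¹ • g) ≤ objective lam T vw :=
    hmax ⟨mem_closedBall_zero_iff.mpr hu1, mem_closedBall_zero_iff.mpr hg1⟩
  have hlower : ‖u‖ * ‖g‖ - ε - 2 * (lam * √(sparsity u)) ≤
      objective lam T (‖u‖⁻¹ • u, ‖g‖⁻¹ • g) := by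
    have hpair := (abs_le.mp (hT _ _ hu1 hg1)).1
    have hpenalty := mul_le_mul_of_nonneg_left (sum_abs_inv_norm_smul_le u) hlam
    rw [inner_inv_norm_smul_self, inner_inv_norm_smul_self] at hpair
    change _ ≤ pairing T (‖u‖⁻¹ • u) (‖g‖⁻¹ • g) - lam * ∑ j, |(‖u‖⁻¹ • u) j|
    linarith
  have hupper : objective lam T vw ≤ |inner ℝ u vw.1| * ‖g‖ + ε := by
    have hpair := (abs_le.mp (hT _ _ hv hw)).2
    have hinner : inner ℝ u vw.1 * inner ℝ g vw.2 ≤ |inner ℝ u vw.1| * ‖g‖ := by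
      refine (le_abs_self _).trans ?_
      rw [abs_mul]
      exact mul_le_mul_of_nonneg_left ((abs_real_inner_le_norm g vw.2).trans
        (mul_le_of_le_one_right (norm_nonneg g) hw)) (abs_nonneg _)
    change pairing T vw.1 vw.2 - lam * ∑ j, |vw.1 j| ≤ _
    linarith
  linarith

/-! ### From regular samples to the estimation error -/

theorem abs_median_sub_le {s : Finset ℕ} (hs : s.Nonempty) {c D : ℝ}
    (h : ∀ t ∈ s, |(t : ℝ) - c| ≤ D) : |median s - c| ≤ D := by
  have hcard := hs.card_pos
  have hmem (i : ℕ) (hi : i < s.card) : s.sort.getD i 0 ∈ s := by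
    rw [List.getD_eq_getElem _ _ (by rwa [Finset.length_sort])]
    exact (Finset.mem_sort (· ≤ ·)).mp (List.getElem_mem _)
  have hlow := abs_le.mp (h _ (hmem ((s.card - 1) / 2) (by omega)))
  have hhigh := abs_le.mp (h _ (hmem (s.card / 2) (by omega)))
  rw [median, abs_le]
  constructor <;> linarith

theorem peakSet_nonempty {k : ℕ} (hk : 0 < k) (f : Fin k → ℝ) : (peakSet f).Nonempty := by
  obtain ⟨i, -, hi⟩ := Finset.exists_max_image Finset.univ (fun i => |f i|)
    ⟨⟨0, hk⟩, Finset.mem_univ _⟩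
  exact ⟨i.val + 1, Finset.mem_image.mpr ⟨i, by simpa using hi, rfl⟩⟩

theorem abs_median_peakSet_sub_le {m z : ℕ} (hz : 0 < z) (hzm : z < m) {f : Fin (m - 1) → ℝ}
    {β e : ℝ} (hβ : β ≠ 0) (hf : ∀ i, |f i - β * cusumCurve m z (i.val + 1)| ≤ e)
    (hsmall : 2 * e / |β| < √(min z (m - z) : ℕ) / 4) :
    |median (peakSet f) - z| ≤ 4 * √(min z (m - z) : ℕ) * (2 * e / |β|) := by
  refine abs_median_sub_le (peakSet_nonempty (by omega) f) fun t ht => ?_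
  obtain ⟨i, hi, rfl⟩ := Finset.mem_image.mp ht
  have hpeak : ∀ i', |f i'| ≤ |f i| := by simpa using hi
  refine abs_sub_le_of_cusumCurve_sub_le hz hzm (by omega) ?_ hsmall
  have habs (t : ℕ) : |β * cusumCurve m z t| = |β| * cusumCurve m z t := by
    rw [abs_mul, abs_of_nonneg (cusumCurve_nonneg m z t)]
  have hchange := (abs_sub_abs_le_abs_sub _ _).trans
    ((abs_sub_comm _ _).trans_le (hf ⟨z - 1, by omega⟩))
  have hloc := (abs_sub_abs_le_abs_sub _ _).trans (hf i)
  have hle := hpeak ⟨z - 1, by omega⟩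
  rw [habs, Nat.sub_add_cancel hz] at hchange
  rw [habs] at hloc
  rw [le_div_iff₀ (abs_pos.mpr hβ)]
  linarith

/-- The expected row amplitudes `θ_j √q_j`: in row `j`, the MissCUSUM transformation of the mean
is approximately this multiple of the CUSUM curve. -/
noncomputable def signal {p : ℕ} (q : Fin p → unitInterval) (θ : EuclideanSpace ℝ (Fin p)) :
    EuclideanSpace ℝ (Fin p) :=
  WithLp.toLp 2 fun j => θ j * √(q j : ℝ)

theorem norm_signal {p : ℕ} (q : Fin p → unitInterval) (θ : EuclideanSpace ℝ (Fin p)) :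
    ‖signal q θ‖ = weightedNorm q θ := by
  simp [EuclideanSpace.norm_eq, signal, weightedNorm, mul_pow, Real.sq_sqrt (q _).2.1]

theorem sparsity_signal_le {p : ℕ} (q : Fin p → unitInterval) (θ : EuclideanSpace ℝ (Fin p)) :
    sparsity (signal q θ) ≤ sparsity θ :=
  Finset.card_le_card <| Finset.monotone_filter_right _ fun _ _ hj => left_ne_zero_of_mul hj

/-- The CUSUM curve as a vector indexed like the columns of the MissCUSUM transformation. -/
noncomputable def curveVector (m z : ℕ) : EuclideanSpace ℝ (Fin (m - 1)) :=
  WithLp.toLp 2 fun i => cusumCurve m z (i.val + 1)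

theorem min_div_three_le_norm_curveVector {m z : ℕ} (hz : 0 < z) (hzm : z < m) :
    ((min z (m - z) : ℕ) : ℝ) / 3 ≤ ‖curveVector m z‖ := by
  refine le_of_sq_le_sq ?_ (norm_nonneg _)
  rw [EuclideanSpace.real_norm_sq_eq]
  have hsum := sum_cusumCurve_sq hz hzm
  rw [Finset.sum_range fun i => cusumCurve m z (i + 1) ^ 2] at hsum
  refine le_trans ?_ hsum
  rw [div_pow]
  linarith [sq_nonneg ((min z (m - z) : ℕ) : ℝ)]

section Decomposition

variable {p m : ℕ}

theorem missCusum_mask (X : Fin p → Fin m → ℝ) (W : Fin p → Fin m → Bool) :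
    missCusum (mask X W) W =
      fun j (i : Fin (m - 1)) => ∑ r, cusumCoef W j (i.val + 1) r * X j r := by
  funext j i
  exact missCusumAt_mask W j X _

/-- The noise part of the MissCUSUM transformation of data `X` with mean `a`: the transformation
of `X` minus that of `a`. -/
noncomputable def cusumNoise (a X : Fin p → Fin m → ℝ) (W : Fin p → Fin m → Bool)
    (j : Fin p) (i : Fin (m - 1)) : ℝ :=
  ∑ r, cusumCoef W j (i.val + 1) r * (X j r - a j r)

theorem cusumNoise_eq_sub (a X : Fin p → Fin m → ℝ) (W : Fin p → Fin m → Bool) (j : Fin p)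
    (i : Fin (m - 1)) :
    cusumNoise a X W j i = missCusum (mask X W) W j i - missCusum (mask a W) W j i := by
  simp only [missCusum_mask, cusumNoise, mul_sub, Finset.sum_sub_distrib]

variable {z : ℕ} {μ₁ μ₂ : EuclideanSpace ℝ (Fin p)} {q : Fin p → unitInterval} {x η : ℝ}
  {X : Fin p → Fin m → ℝ} {W : Fin p → Fin m → Bool}

theorem abs_missCusum_meanMatrix_sub_le
    (hW : ∀ j, (μ₂ - μ₁) j ≠ 0 → CountsClose q x W j) (hz : z ≤ m) (j : Fin p)
    (i : Fin (m - 1)) :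
    |missCusum (mask (meanMatrix m z μ₁ μ₂) W) W j i -
        signal q (μ₂ - μ₁) j * curveVector m z i| ≤ |(μ₂ - μ₁) j| * (5 * x) := by
  rw [missCusum_mask]
  exact abs_cusum_meanMatrix_sub_le (hW j) hz (by omega)

theorem half_weightedNorm_le_abs_inner_of_mem_argmaxSet (hz : 0 < z) (hzm : z < m) {lam : ℝ}
    {vw : EuclideanSpace ℝ (Fin p) × EuclideanSpace ℝ (Fin (m - 1))}
    (hvw : vw ∈ argmaxSet lam (missCusum (mask X W) W))
    (hW : ∀ j, (μ₂ - μ₁) j ≠ 0 → CountsClose q x W j)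
    (hX : ∀ j i, |cusumNoise (meanMatrix m z μ₁ μ₂) X W j i| ≤ η)
    (hx : 0 ≤ x) (hη : 0 ≤ η) (hlam : √m * η ≤ lam)
    (hsnr : 2 * (√m * (5 * x) * ‖μ₂ - μ₁‖) + 2 * (lam * √(sparsity (μ₂ - μ₁))) ≤
      weightedNorm q (μ₂ - μ₁) * (min z (m - z) : ℕ) / 6) :
    weightedNorm q (μ₂ - μ₁) / 2 ≤ |inner ℝ (signal q (μ₂ - μ₁)) vw.1| := by
  have hlam0 : 0 ≤ lam := le_trans (by positivity) hlam
  have hm : √(Fintype.card (Fin (m - 1)) : ℝ) ≤ √m := by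
    rw [Fintype.card_fin]
    exact Real.sqrt_le_sqrt (by exact_mod_cast Nat.sub_le m 1)
  have hpairing (v w) (hv : ‖v‖ ≤ 1) (hw : ‖w‖ ≤ 1) :
      |pairing (missCusum (mask X W) W) v w -
        inner ℝ (signal q (μ₂ - μ₁)) v * inner ℝ (curveVector m z) w| ≤
      lam * ∑ j, |v j| + √m * (5 * x) * ‖μ₂ - μ₁‖ := by
    refine (abs_pairing_sub_rankOne_le
      (fun j i => (cusumNoise_eq_sub _ _ _ _ _).symm ▸ hX j i)
      (abs_missCusum_meanMatrix_sub_le hW hzm.le) hη (by positivity) hv hw).trans ?_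
    gcongr
    exact (mul_le_mul_of_nonneg_right hm hη).trans hlam
  have halign := le_abs_inner_mul_norm_of_mem_argmaxSet hvw hlam0 hpairing
  have hcurve := min_div_three_le_norm_curveVector hz hzm
  have hmin : (0 : ℝ) < (min z (m - z) : ℕ) := by exact_mod_cast (by omega : 0 < min z (m - z))
  have hsparse : lam * √(sparsity (signal q (μ₂ - μ₁))) ≤ lam * √(sparsity (μ₂ - μ₁)) := by
    gcongr
    exact sparsity_signal_le q _
  have hsignal : weightedNorm q (μ₂ - μ₁) * ((min z (m - z) : ℕ) / 3) ≤
      weightedNorm q (μ₂ - μ₁) * ‖curveVector m z‖ :=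
    mul_le_mul_of_nonneg_left hcurve (Real.sqrt_nonneg _)
  rw [norm_signal] at halign
  refine le_of_mul_le_mul_right ?_ (lt_of_lt_of_le (by positivity) hcurve)
  linarith

theorem abs_project_missCusum_sub_le (hz : z ≤ m) {v : EuclideanSpace ℝ (Fin p)} (hv : ‖v‖ ≤ 1)
    (hW : ∀ j, (μ₂ - μ₁) j ≠ 0 → CountsClose q x W j) (hx : 0 ≤ x) {i : Fin (m - 1)}
    (hX : |∑ j, v j * cusumNoise (meanMatrix m z μ₁ μ₂) X W j i| ≤ η) :
    |project v (missCusum (mask X W) W) i -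
        inner ℝ (signal q (μ₂ - μ₁)) v * cusumCurve m z (i.val + 1)| ≤
      5 * x * ‖μ₂ - μ₁‖ + η := by
  have hsplit : project v (missCusum (mask X W) W) i -
        inner ℝ (signal q (μ₂ - μ₁)) v * cusumCurve m z (i.val + 1) =
      ∑ j, v j * (missCusum (mask (meanMatrix m z μ₁ μ₂) W) W j i -
        signal q (μ₂ - μ₁) j * curveVector m z i) +
      ∑ j, v j * cusumNoise (meanMatrix m z μ₁ μ₂) X W j i := by
    simp only [project, cusumNoise_eq_sub, PiLp.inner_apply, RCLike.inner_apply, conj_trivial,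
      Finset.sum_mul, ← Finset.sum_sub_distrib, ← Finset.sum_add_distrib, curveVector]
    exact Finset.sum_congr rfl fun j _ => by ring
  have hmean : |∑ j, v j * (missCusum (mask (meanMatrix m z μ₁ μ₂) W) W j i -
      signal q (μ₂ - μ₁) j * curveVector m z i)| ≤ 5 * x * ‖μ₂ - μ₁‖ := calc
    _ ≤ ∑ j, |v j| * (|(μ₂ - μ₁) j| * (5 * x)) := by
      refine (Finset.abs_sum_le_sum_abs _ _).trans (Finset.sum_le_sum fun j _ => ?_)
      rw [abs_mul]
      exact mul_le_mul_of_nonneg_left (abs_missCusum_meanMatrix_sub_le hW hz j i) (abs_nonneg _)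
    _ = 5 * x * ∑ j, |(μ₂ - μ₁) j| * |v j| := by
      rw [Finset.mul_sum]
      exact Finset.sum_congr rfl fun j _ => by ring
    _ ≤ 5 * x * ‖μ₂ - μ₁‖ := by
      gcongr
      exact (sum_abs_mul_abs_le_norm_mul_norm _ _).trans
        (mul_le_of_le_one_right (norm_nonneg _) hv)
  rw [hsplit]
  exact (abs_add_le _ _).trans (add_le_add hmean hX)

end Decomposition

section RegularSample

variable {p m : ℕ}

/-- The odd and the even half-sample, as pairs of data matrices and of revelation matrices. -/
abbrev SplitSample (p m : ℕ) : Type :=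
  ((Fin p → Fin m → ℝ) × (Fin p → Fin m → ℝ)) × ((Fin p → Fin m → Bool) × (Fin p → Fin m → Bool))

/-- The good event of the analysis: in the rows that change, the observation counts of both
half-samples are within `x` of their means on the square-root scale; the MissCUSUM noise is at
most `η₁` entrywise in the odd half, and at most `η₂` in the even half once projected along the
direction `v` computed from the odd half. -/
structure IsRegular (z : ℕ) (μ₁ μ₂ : EuclideanSpace ℝ (Fin p)) (q : Fin p → unitInterval)
    (v : (Fin p → Fin (m - 1) → ℝ) → EuclideanSpace ℝ (Fin p)) (x η₁ η₂ : ℝ)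
    (d : SplitSample p m) : Prop where
  oddCounts : ∀ j, (μ₂ - μ₁) j ≠ 0 → CountsClose q x d.2.1 j
  evenCounts : ∀ j, (μ₂ - μ₁) j ≠ 0 → CountsClose q x d.2.2 j
  oddNoise : ∀ j i, |cusumNoise (meanMatrix m z μ₁ μ₂) d.1.1 d.2.1 j i| ≤ η₁
  evenNoise : ∀ i, |∑ j, v (missCusum (mask d.1.1 d.2.1) d.2.1) j *
    cusumNoise (meanMatrix m z μ₁ μ₂) d.1.2 d.2.2 j i| ≤ η₂

theorem IsRegular.abs_estimate_sub_le {z : ℕ} {μ₁ μ₂ : EuclideanSpace ℝ (Fin p)}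
    {q : Fin p → unitInterval} {x η₁ η₂ lam : ℝ}
    {opt : (Fin p → Fin (m - 1) → ℝ) → EuclideanSpace ℝ (Fin p) × EuclideanSpace ℝ (Fin (m - 1))}
    {d : SplitSample p m} (hd : IsRegular z μ₁ μ₂ q (fun T => (opt T).1) x η₁ η₂ d)
    (hz : 0 < z) (hzm : z < m) (hopt : ∀ T, opt T ∈ argmaxSet lam T)
    (hx : 0 ≤ x) (hη₁ : 0 ≤ η₁) (hlam : √m * η₁ ≤ lam) (hU : 0 < weightedNorm q (μ₂ - μ₁))
    (halign : 2 * (√m * (5 * x) * ‖μ₂ - μ₁‖) + 2 * (lam * √(sparsity (μ₂ - μ₁))) ≤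
      weightedNorm q (μ₂ - μ₁) * (min z (m - z) : ℕ) / 6)
    (hpeak : 4 * (5 * x * ‖μ₂ - μ₁‖ + η₂) / weightedNorm q (μ₂ - μ₁) <
      √(min z (m - z) : ℕ) / 4) :
    |median (peakSet (project (opt (missCusum (mask d.1.1 d.2.1) d.2.1)).1
        (missCusum (mask d.1.2 d.2.2) d.2.2))) - z| ≤
      4 * √(min z (m - z) : ℕ) *
        (4 * (5 * x * ‖μ₂ - μ₁‖ + η₂) / weightedNorm q (μ₂ - μ₁)) := by
  have hhalf := half_weightedNorm_le_abs_inner_of_mem_argmaxSet hz hzm (hopt _) hd.oddCounts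
    hd.oddNoise hx hη₁ hlam halign
  have hv := mem_closedBall_zero_iff.mp (hopt (missCusum (mask d.1.1 d.2.1) d.2.1)).1.1
  have hseries := fun i => abs_project_missCusum_sub_le hzm.le hv hd.evenCounts hx (hd.evenNoise i)
  have herror : 0 ≤ 5 * x * ‖μ₂ - μ₁‖ + η₂ := (abs_nonneg _).trans (hseries ⟨0, by omega⟩)
  have hβ := lt_of_lt_of_le (half_pos hU) hhalf
  have hquot : 2 * (5 * x * ‖μ₂ - μ₁‖ + η₂) / |inner ℝ (signal q (μ₂ - μ₁))
        (opt (missCusum (mask d.1.1 d.2.1) d.2.1)).1| ≤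
      4 * (5 * x * ‖μ₂ - μ₁‖ + η₂) / weightedNorm q (μ₂ - μ₁) := by
    rw [div_le_div_iff₀ hβ hU]
    nlinarith
  exact (abs_median_peakSet_sub_le hz hzm (abs_pos.mp hβ) hseries
    (hquot.trans_lt hpeak)).trans (mul_le_mul_of_nonneg_left hquot (by positivity))

end RegularSample

/-! ### The law of the half-samples and the good event -/

/-- The law of the data matrix: independent columns `N(mean, σ² I)` with a change in mean after
time `z`. -/
noncomputable def dataLaw {p : ℕ} (n z : ℕ) (μ₁ μ₂ : EuclideanSpace ℝ (Fin p)) (σ : ℝ) :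
    Measure (Fin p → Fin n → ℝ) :=
  Measure.pi fun j => Measure.pi fun r =>
    gaussianReal (meanMatrix n z μ₁ μ₂ j r) (Real.toNNReal (σ ^ 2))

/-- The law of the revelation matrix: independent entries, Bernoulli with parameter `q j` in
row `j`. -/
noncomputable def revelationLaw {p : ℕ} (n : ℕ) (q : Fin p → unitInterval) :
    Measure (Fin p → Fin n → Bool) :=
  Measure.pi fun j => Measure.pi fun _ => bernoulliMeasure true false (q j)

instance {p n z : ℕ} (μ₁ μ₂ : EuclideanSpace ℝ (Fin p)) (σ : ℝ) :
    IsProbabilityMeasure (dataLaw n z μ₁ μ₂ σ) := by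
  unfold dataLaw
  infer_instance

instance {p n : ℕ} (q : Fin p → unitInterval) : IsProbabilityMeasure (revelationLaw n q) := by
  unfold revelationLaw
  infer_instance

/-- The joint law of the two half-samples: two independent data matrices and two independent
revelation matrices. -/
noncomputable def splitLaw {p : ℕ} (m z : ℕ) (μ₁ μ₂ : EuclideanSpace ℝ (Fin p)) (σ : ℝ)
    (q : Fin p → unitInterval) : Measure (SplitSample p m) :=
  ((dataLaw m z μ₁ μ₂ σ).prod (dataLaw m z μ₁ μ₂ σ)).prod
    ((revelationLaw m q).prod (revelationLaw m q))

/-- Rearranges a sample into its odd and its even columns. -/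
def splitColumns {p n : ℕ} (d : (Fin p → Fin n → ℝ) × (Fin p → Fin n → Bool)) :
    SplitSample p (n / 2) :=
  ((oddColumns d.1, evenColumns d.1), (oddColumns d.2, evenColumns d.2))

theorem oddColumns_meanMatrix {p n z : ℕ} (hz : Even z) (μ₁ μ₂ : EuclideanSpace ℝ (Fin p)) :
    oddColumns (meanMatrix n z μ₁ μ₂) = meanMatrix (n / 2) (z / 2) μ₁ μ₂ := by
  obtain ⟨ζ, rfl⟩ := hz
  funext j r
  exact if_congr (by lia) rfl rfl

theorem evenColumns_meanMatrix {p n z : ℕ} (hz : Even z) (μ₁ μ₂ : EuclideanSpace ℝ (Fin p)) :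
    evenColumns (meanMatrix n z μ₁ μ₂) = meanMatrix (n / 2) (z / 2) μ₁ μ₂ := by
  obtain ⟨ζ, rfl⟩ := hz
  funext j r
  exact if_congr (by lia) rfl rfl

theorem measurePreserving_splitColumns {p n z : ℕ} (hn : Even n) (hz : Even z)
    (μ₁ μ₂ : EuclideanSpace ℝ (Fin p)) (σ : ℝ) (q : Fin p → unitInterval) :
    MeasurePreserving splitColumns (changepointLaw n z μ₁ μ₂ σ q)
      (splitLaw (n / 2) (z / 2) μ₁ μ₂ σ q) := by
  have hdata : MeasurePreserving (fun X : Fin p → Fin n → ℝ => (oddColumns X, evenColumns X))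
      (dataLaw n z μ₁ μ₂ σ)
      ((dataLaw (n / 2) (z / 2) μ₁ μ₂ σ).prod (dataLaw (n / 2) (z / 2) μ₁ μ₂ σ)) := by
    let ν (j : Fin p) (r : Fin n) : Measure ℝ :=
      gaussianReal (meanMatrix n z μ₁ μ₂ j r) (Real.toNNReal (σ ^ 2))
    have hodd : dataLaw (n / 2) (z / 2) μ₁ μ₂ σ =
        Measure.pi fun j => Measure.pi (oddColumns ν j) := by
      rw [dataLaw, ← oddColumns_meanMatrix hz]
      rfl
    have heven : dataLaw (n / 2) (z / 2) μ₁ μ₂ σ =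
        Measure.pi fun j => Measure.pi (evenColumns ν j) := by
      rw [dataLaw, ← evenColumns_meanMatrix hz]
      rfl
    have h := measurePreserving_oddColumns_evenColumns hn ν
    rwa [← hodd, ← heven] at h
  exact hdata.prod (measurePreserving_oddColumns_evenColumns hn fun (j : Fin p) (_ : Fin n) =>
    bernoulliMeasure true false (q j))

theorem measure_iUnion_le_ofReal_mul {α ι : Type*} [MeasurableSpace α] [Fintype ι] (μ : Measure α)
    {s : ι → Set α} {N c : ℝ} (hN : (Fintype.card ι : ℝ) ≤ N) (hc : 0 ≤ c)
    (h : ∀ i, μ (s i) ≤ ENNReal.ofReal c) : μ (⋃ i, s i) ≤ ENNReal.ofReal (N * c) := by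
  calc μ (⋃ i, s i) ≤ ∑ _ : ι, ENNReal.ofReal c :=
      (measure_iUnion_fintype_le μ s).trans (Finset.sum_le_sum fun i _ => h i)
    _ = ENNReal.ofReal (Fintype.card ι * c) := by
      rw [Finset.sum_const, Finset.card_univ, nsmul_eq_mul, ENNReal.ofReal_mul (Nat.cast_nonneg _),
        ENNReal.ofReal_natCast]
    _ ≤ ENNReal.ofReal (N * c) := ENNReal.ofReal_le_ofReal (by gcongr)

section Counts

theorem card_filter_val_add_one_le {m t : ℕ} (ht : t ≤ m) :
    (Finset.univ.filter fun r : Fin m => r.val + 1 ≤ t).card = t :=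
  Fin.card_filter_val_lt.trans (min_eq_right ht)

theorem card_filter_le_val_add_one_add {m t : ℕ} (ht : t ≤ m) :
    (Finset.univ.filter fun r : Fin m => m + 1 ≤ r.val + 1 + t).card = t := by
  refine (Finset.card_equiv Fin.revPerm fun r => ?_).trans (card_filter_val_add_one_le ht)
  simp only [Finset.mem_filter, Finset.mem_univ, true_and, Fin.revPerm_apply, Fin.val_rev]
  omega

variable {p m : ℕ} (q : Fin p → unitInterval) {x : ℝ}

theorem revelationLaw_sqrt_count_tail (hx : 0 ≤ x) (j : Fin p) (S : Finset (Fin m)) :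
    revelationLaw m q {W | x < |√((S.filter fun r => W j r).card : ℝ) - √(q j * S.card)|} ≤
      ENNReal.ofReal (2 * Real.exp (-x ^ 2)) :=
  ((measurePreserving_eval
    (fun j => Measure.pi fun _ : Fin m => bernoulliMeasure true false (q j)) j).measure_preimage
      (Set.toFinite _).measurableSet.nullMeasurableSet).trans_le (sqrt_count_tail (q j) S hx)

theorem revelationLaw_not_countsClose_le (hx : 0 ≤ x) (j : Fin p) :
    revelationLaw m q {W | ¬ CountsClose q x W j} ≤
      ENNReal.ofReal ((m + 1) * (4 * Real.exp (-x ^ 2))) := by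
  let bad (t : Fin (m + 1)) : Set (Fin p → Fin m → Bool) :=
    {W | x < |√(leftCount W j t) - √(q j * t)|} ∪ {W | x < |√(rightCount W j t) - √(q j * t)|}
  have hbad (t : Fin (m + 1)) :
      revelationLaw m q (bad t) ≤ ENNReal.ofReal (4 * Real.exp (-x ^ 2)) := by
    have ht : t.val ≤ m := Nat.le_of_lt_succ t.isLt
    have hleft := revelationLaw_sqrt_count_tail q hx j
      (Finset.univ.filter fun r : Fin m => r.val + 1 ≤ t)
    have hright := revelationLaw_sqrt_count_tail q hx j
      (Finset.univ.filter fun r : Fin m => m + 1 ≤ r.val + 1 + t)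
    rw [card_filter_val_add_one_le ht] at hleft
    rw [card_filter_le_val_add_one_add ht] at hright
    simp only [Finset.filter_filter] at hleft hright
    refine (measure_union_le _ _).trans ((add_le_add hleft hright).trans_eq ?_)
    rw [← ENNReal.ofReal_add (by positivity) (by positivity)]
    ring_nf
  refine (measure_mono fun W hW => ?_).trans
    (measure_iUnion_le_ofReal_mul _ (N := m + 1) (by simp) (by positivity) hbad)
  by_contra hgood
  refine hW fun t ht => ?_
  have := fun h => hgood (Set.mem_iUnion.mpr ⟨⟨t, Nat.lt_succ_of_le ht⟩, h⟩)
  exact ⟨not_lt.mp fun h => this (Or.inl h), not_lt.mp fun h => this (Or.inr h)⟩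

theorem revelationLaw_exists_not_countsClose_le (hx : 0 ≤ x) (θ : EuclideanSpace ℝ (Fin p)) :
    revelationLaw m q {W | ∃ j, θ j ≠ 0 ∧ ¬ CountsClose q x W j} ≤
      ENNReal.ofReal (sparsity θ * ((m + 1) * (4 * Real.exp (-x ^ 2)))) := by
  have hunion : {W : Fin p → Fin m → Bool | ∃ j, θ j ≠ 0 ∧ ¬ CountsClose q x W j} =
      ⋃ j : {j // θ j ≠ 0}, {W | ¬ CountsClose q x W j} := by
    ext W
    simp
  rw [hunion]
  exact measure_iUnion_le_ofReal_mul _ (by rw [Fintype.card_subtype, sparsity]) (by positivity)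
    fun j => revelationLaw_not_countsClose_le q hx j

end Counts

section Noise

variable {p m z : ℕ} {μ₁ μ₂ : EuclideanSpace ℝ (Fin p)} {σ y : ℝ}

theorem dataLaw_project_cusumNoise_tail (hσ : 0 < σ) (hy : 0 ≤ y) (W : Fin p → Fin m → Bool)
    {v : EuclideanSpace ℝ (Fin p)} (hv : ‖v‖ ≤ 1) (i : Fin (m - 1)) :
    dataLaw m z μ₁ μ₂ σ
        {X | σ * y < |∑ j, v j * cusumNoise (meanMatrix m z μ₁ μ₂) X W j i|} ≤
      ENNReal.ofReal (2 * Real.exp (-(y ^ 2 / 2))) := by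
  have hcoef : ∑ j, ∑ r, (v j * cusumCoef W j (i.val + 1) r) ^ 2 ≤ 1 := calc
    _ = ∑ j, v j ^ 2 * ∑ r, cusumCoef W j (i.val + 1) r ^ 2 := by
      simp only [mul_pow, Finset.mul_sum]
    _ ≤ ∑ j, v j ^ 2 := Finset.sum_le_sum fun j _ =>
      mul_le_of_le_one_right (sq_nonneg _) (sum_cusumCoef_sq_le W j (by omega))
    _ = ‖v‖ ^ 2 := (EuclideanSpace.real_norm_sq_eq v).symm
    _ ≤ 1 := pow_le_one₀ (norm_nonneg v) hv
  simpa only [dataLaw, cusumNoise, Finset.mul_sum, mul_assoc] using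
    gaussian_linear_tail (meanMatrix m z μ₁ μ₂) hσ hy hcoef

theorem dataLaw_cusumNoise_tail (hσ : 0 < σ) (hy : 0 ≤ y) (W : Fin p → Fin m → Bool) (j : Fin p)
    (i : Fin (m - 1)) :
    dataLaw m z μ₁ μ₂ σ {X | σ * y < |cusumNoise (meanMatrix m z μ₁ μ₂) X W j i|} ≤
      ENNReal.ofReal (2 * Real.exp (-(y ^ 2 / 2))) := by
  have h := dataLaw_project_cusumNoise_tail (μ₁ := μ₁) (μ₂ := μ₂) (z := z) hσ hy W
    (v := EuclideanSpace.single j 1) (by simp) i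
  simpa [Pi.single_apply] using h

end Noise

section GoodEvent

variable {p m : ℕ}

theorem measurable_cusumNoise (a : Fin p → Fin m → ℝ) (j : Fin p) (i : Fin (m - 1)) :
    Measurable fun d : (Fin p → Fin m → ℝ) × (Fin p → Fin m → Bool) =>
      cusumNoise a d.1 d.2 j i := by
  refine measurable_from_prod_countable_left fun W => ?_
  unfold cusumNoise
  fun_prop

theorem measurable_missCusum_mask :
    Measurable fun d : (Fin p → Fin m → ℝ) × (Fin p → Fin m → Bool) =>
      missCusum (mask d.1 d.2) d.2 := by
  refine measurable_from_prod_countable_left fun W => ?_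
  simp only [missCusum_mask]
  fun_prop

theorem measurable_project_cusumNoise (a : Fin p → Fin m → ℝ)
    {v : (Fin p → Fin (m - 1) → ℝ) → EuclideanSpace ℝ (Fin p)} (hv : Measurable v)
    (i : Fin (m - 1)) :
    Measurable fun d : SplitSample p m =>
      ∑ j, v (missCusum (mask d.1.1 d.2.1) d.2.1) j * cusumNoise a d.1.2 d.2.2 j i := by
  have hodd : Measurable fun d : SplitSample p m => (d.1.1, d.2.1) := by fun_prop
  have heven : Measurable fun d : SplitSample p m => (d.1.2, d.2.2) := by fun_prop
  have hdirection (j : Fin p) : Measurable fun d : SplitSample p m =>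
      v (missCusum (mask d.1.1 d.2.1) d.2.1) j := by
    have hcoord : Measurable fun u : EuclideanSpace ℝ (Fin p) => u j := by fun_prop
    have h : Measurable fun e : (Fin p → Fin m → ℝ) × (Fin p → Fin m → Bool) =>
        v (missCusum (mask e.1 e.2) e.2) j := hcoord.comp (hv.comp measurable_missCusum_mask)
    exact h.comp hodd
  have hnoise (j : Fin p) : Measurable fun d : SplitSample p m => cusumNoise a d.1.2 d.2.2 j i := by
    have h := (measurable_cusumNoise a j i).comp heven
    exact h
  exact Finset.measurable_sum _ fun j _ => (hdirection j).mul (hnoise j)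

variable {z : ℕ} {μ₁ μ₂ : EuclideanSpace ℝ (Fin p)} {σ x y : ℝ} {q : Fin p → unitInterval}

theorem splitLaw_oddCounts_le (hx : 0 ≤ x) :
    splitLaw m z μ₁ μ₂ σ q {d | ∃ j, (μ₂ - μ₁) j ≠ 0 ∧ ¬ CountsClose q x d.2.1 j} ≤
      ENNReal.ofReal (sparsity (μ₂ - μ₁) * ((m + 1) * (4 * Real.exp (-x ^ 2)))) := by
  have hS : MeasurableSet {W : Fin p → Fin m → Bool |
    ∃ j, (μ₂ - μ₁) j ≠ 0 ∧ ¬ CountsClose q x W j} := (Set.toFinite _).measurableSet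
  refine prod_apply_le_of_forall_fst _ _ (hS.preimage (by fun_prop)) fun _ => ?_
  exact prod_apply_le_of_forall_snd _ _ (hS.preimage measurable_fst) fun _ =>
    revelationLaw_exists_not_countsClose_le q hx _

theorem splitLaw_evenCounts_le (hx : 0 ≤ x) :
    splitLaw m z μ₁ μ₂ σ q {d | ∃ j, (μ₂ - μ₁) j ≠ 0 ∧ ¬ CountsClose q x d.2.2 j} ≤
      ENNReal.ofReal (sparsity (μ₂ - μ₁) * ((m + 1) * (4 * Real.exp (-x ^ 2)))) := by
  have hS : MeasurableSet {W : Fin p → Fin m → Bool |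
    ∃ j, (μ₂ - μ₁) j ≠ 0 ∧ ¬ CountsClose q x W j} := (Set.toFinite _).measurableSet
  refine prod_apply_le_of_forall_fst _ _ (hS.preimage (by fun_prop)) fun _ => ?_
  exact prod_apply_le_of_forall_fst _ _ (hS.preimage measurable_snd) fun _ =>
    revelationLaw_exists_not_countsClose_le q hx _

theorem splitLaw_oddNoise_le (hσ : 0 < σ) (hy : 0 ≤ y) :
    splitLaw m z μ₁ μ₂ σ q
        (⋃ ji : Fin p × Fin (m - 1),
          {d | σ * y < |cusumNoise (meanMatrix m z μ₁ μ₂) d.1.1 d.2.1 ji.1 ji.2|}) ≤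
      ENNReal.ofReal (p * m * (2 * Real.exp (-(y ^ 2 / 2)))) := by
  have hcard : (Fintype.card (Fin p × Fin (m - 1)) : ℝ) ≤ p * m := by
    rw [Fintype.card_prod, Fintype.card_fin, Fintype.card_fin]
    exact_mod_cast Nat.mul_le_mul_left p (Nat.sub_le m 1)
  refine measure_iUnion_le_ofReal_mul _ hcard (by positivity) fun ⟨j, i⟩ => ?_
  have hodd : Measurable fun d : SplitSample p m => (d.1.1, d.2.1) := by fun_prop
  have hS := measurableSet_lt (measurable_const (a := σ * y))
    ((measurable_cusumNoise (meanMatrix m z μ₁ μ₂) j i).comp hodd).abs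
  refine prod_apply_le_of_forall_snd _ _ hS fun W => ?_
  exact prod_apply_le_of_forall_snd _ _ (hS.preimage measurable_prodMk_right) fun _ =>
    dataLaw_cusumNoise_tail hσ hy W.1 j i

/-- Conditionally on the odd half-sample, the direction is fixed and the noise of the even
half-sample is centred Gaussian: this is what sample splitting achieves. -/
theorem splitLaw_evenNoise_le (hσ : 0 < σ) (hy : 0 ≤ y)
    {v : (Fin p → Fin (m - 1) → ℝ) → EuclideanSpace ℝ (Fin p)} (hv : Measurable v)
    (hv1 : ∀ T, ‖v T‖ ≤ 1) :
    splitLaw m z μ₁ μ₂ σ q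
        (⋃ i, {d | σ * y < |∑ j, v (missCusum (mask d.1.1 d.2.1) d.2.1) j *
          cusumNoise (meanMatrix m z μ₁ μ₂) d.1.2 d.2.2 j i|}) ≤
      ENNReal.ofReal (m * (2 * Real.exp (-(y ^ 2 / 2)))) := by
  have hcard : (Fintype.card (Fin (m - 1)) : ℝ) ≤ m := by
    rw [Fintype.card_fin]
    exact_mod_cast Nat.sub_le m 1
  refine measure_iUnion_le_ofReal_mul _ hcard (by positivity) fun i => ?_
  have hS := measurableSet_lt (measurable_const (a := σ * y))
    (measurable_project_cusumNoise (meanMatrix m z μ₁ μ₂) hv i).abs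
  refine prod_apply_le_of_forall_snd _ _ hS fun W => ?_
  refine prod_apply_le_of_forall_fst _ _ (hS.preimage measurable_prodMk_right) fun X => ?_
  exact dataLaw_project_cusumNoise_tail hσ hy W.2 (hv1 (missCusum (mask X W.1) W.1)) i

theorem splitLaw_not_isRegular_le (hσ : 0 < σ) {y₁ y₂ : ℝ} (hx : 0 ≤ x) (hy₁ : 0 ≤ y₁)
    (hy₂ : 0 ≤ y₂) {v : (Fin p → Fin (m - 1) → ℝ) → EuclideanSpace ℝ (Fin p)}
    (hv : Measurable v) (hv1 : ∀ T, ‖v T‖ ≤ 1) :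
    splitLaw m z μ₁ μ₂ σ q {d | ¬ IsRegular z μ₁ μ₂ q v x (σ * y₁) (σ * y₂) d} ≤
      ENNReal.ofReal (sparsity (μ₂ - μ₁) * ((m + 1) * (4 * Real.exp (-x ^ 2))) +
        sparsity (μ₂ - μ₁) * ((m + 1) * (4 * Real.exp (-x ^ 2))) +
        p * m * (2 * Real.exp (-(y₁ ^ 2 / 2))) + m * (2 * Real.exp (-(y₂ ^ 2 / 2)))) := by
  rw [ENNReal.ofReal_add (by positivity) (by positivity),
    ENNReal.ofReal_add (by positivity) (by positivity),
    ENNReal.ofReal_add (by positivity) (by positivity)]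
  refine (measure_mono fun d hd => ?_).trans <| (measure_union_le _ _).trans <| add_le_add
    ((measure_union_le _ _).trans <| add_le_add ((measure_union_le _ _).trans <| add_le_add
      (splitLaw_oddCounts_le hx) (splitLaw_evenCounts_le hx)) (splitLaw_oddNoise_le hσ hy₁))
    (splitLaw_evenNoise_le hσ hy₂ hv hv1)
  by_contra hgood
  simp only [Set.mem_union, Set.mem_iUnion, Set.mem_ofPred_eq, not_or, not_exists, not_and,
    not_not, not_lt, Prod.forall] at hgood
  obtain ⟨⟨⟨hodd, heven⟩, hoddNoise⟩, hevenNoise⟩ := hgood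
  exact hd ⟨hodd, heven, hoddNoise, hevenNoise⟩

end GoodEvent

/-! ### Calibration -/

theorem exp_neg_sq_two_mul_sqrt_log {a : ℝ} (ha : 1 ≤ a) :
    Real.exp (-((2 * √(Real.log a)) ^ 2 / 2)) = (a ^ 2)⁻¹ := by
  have hlog : (2 * √(Real.log a)) ^ 2 / 2 = Real.log (a ^ 2) := by
    rw [mul_pow, Real.sq_sqrt (Real.log_nonneg ha), Real.log_pow]
    push_cast
    ring
  rw [hlog, Real.exp_neg, Real.exp_log (by positivity)]

theorem mul_exp_neg_sq_two_mul_sqrt_log_le {a b n : ℝ} (ha : 1 ≤ a) (hn : 1 ≤ n) (hb : b ≤ n) :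
    a * b * Real.exp (-((2 * √(Real.log (a * n))) ^ 2 / 2)) ≤ 1 / n := by
  rw [exp_neg_sq_two_mul_sqrt_log (one_le_mul_of_one_le_of_one_le ha hn), ← div_eq_mul_inv,
    div_le_div_iff₀ (by positivity) (by positivity), one_mul]
  calc a * b * n ≤ a * n * n := by gcongr
    _ ≤ a * (a * n * n) := le_mul_of_one_le_left (by positivity) ha
    _ = (a * n) ^ 2 := by ring

section Vectors

variable {p : ℕ} {θ : EuclideanSpace ℝ (Fin p)}

theorem exists_apply_ne_zero (hθ : θ ≠ 0) : ∃ j, θ j ≠ 0 := by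
  by_contra! h
  exact hθ (PiLp.ext h)

theorem weightedNorm_pos {q : Fin p → unitInterval} (hq : ∀ j, 0 < q j) (hθ : θ ≠ 0) :
    0 < weightedNorm q θ := by
  obtain ⟨j, hj⟩ := exists_apply_ne_zero hθ
  exact Real.sqrt_pos.mpr (Finset.sum_pos' (fun i _ => mul_nonneg (sq_nonneg _) (q i).2.1)
    ⟨j, Finset.mem_univ j, mul_pos (by positivity) (by exact_mod_cast hq j)⟩)

theorem sparsity_pos (hθ : θ ≠ 0) : 0 < sparsity θ := by
  obtain ⟨j, hj⟩ := exists_apply_ne_zero hθ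
  exact Finset.card_pos.mpr ⟨j, Finset.mem_filter.mpr ⟨Finset.mem_univ j, hj⟩⟩

theorem sparsity_le (θ : EuclideanSpace ℝ (Fin p)) : sparsity θ ≤ p :=
  (Finset.card_filter_le _ _).trans_eq (by rw [Finset.card_univ, Fintype.card_fin])

end Vectors

section Typical

variable {p n z : ℕ} {μ₁ μ₂ : EuclideanSpace ℝ (Fin p)} {σ : ℝ} {q : Fin p → unitInterval}

/-- The good event at the levels for which a union bound gives probability `1 - O(1 / n)`: the
`√log` factors match the number of events of each kind. -/
def typicalSamples (n z : ℕ) (μ₁ μ₂ : EuclideanSpace ℝ (Fin p)) (σ : ℝ) (q : Fin p → unitInterval)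
    (v : (Fin p → Fin (n / 2 - 1) → ℝ) → EuclideanSpace ℝ (Fin p)) :
    Set (SplitSample p (n / 2)) :=
  {d | IsRegular (z / 2) μ₁ μ₂ q v (2 * √(Real.log (sparsity (μ₂ - μ₁) * n)))
    (σ * (2 * √(Real.log (p * n)))) (σ * (2 * √(Real.log (sparsity (μ₂ - μ₁) * n)))) d}

theorem splitLaw_compl_typicalSamples_le (hn : 2 ≤ n) (hσ : 0 < σ) (hθ : μ₂ - μ₁ ≠ 0)
    {v : (Fin p → Fin (n / 2 - 1) → ℝ) → EuclideanSpace ℝ (Fin p)} (hv : Measurable v)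
    (hv1 : ∀ T, ‖v T‖ ≤ 1) :
    splitLaw (n / 2) (z / 2) μ₁ μ₂ σ q (typicalSamples n z μ₁ μ₂ σ q v)ᶜ ≤
      ENNReal.ofReal (22 / n) := by
  refine (splitLaw_not_isRegular_le hσ (by positivity) (by positivity) (by positivity) hv
    hv1).trans (ENNReal.ofReal_le_ofReal ?_)
  set x := 2 * √(Real.log (sparsity (μ₂ - μ₁) * n))
  have hs : (1 : ℝ) ≤ sparsity (μ₂ - μ₁) := by exact_mod_cast sparsity_pos hθ
  have hp : (1 : ℝ) ≤ p := hs.trans (by exact_mod_cast sparsity_le _)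
  have hn1 : (1 : ℝ) ≤ n := by exact_mod_cast (by omega : 1 ≤ n)
  have hm : ((n / 2 : ℕ) : ℝ) + 1 ≤ n := by exact_mod_cast (by omega : n / 2 + 1 ≤ n)
  have hexp : Real.exp (-x ^ 2) ≤ Real.exp (-(x ^ 2 / 2)) :=
    Real.exp_le_exp.mpr (by linarith [sq_nonneg x])
  have hcounts : (sparsity (μ₂ - μ₁) : ℝ) * (((n / 2 : ℕ) + 1) * (4 * Real.exp (-x ^ 2))) ≤
      4 * (1 / n) := calc
    _ ≤ 4 * (sparsity (μ₂ - μ₁) * ((n / 2 : ℕ) + 1) * Real.exp (-(x ^ 2 / 2))) := by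
      rw [← mul_assoc, mul_left_comm]
      gcongr
    _ ≤ 4 * (1 / n) := by
      gcongr
      exact mul_exp_neg_sq_two_mul_sqrt_log_le hs hn1 hm
  have hodd := mul_exp_neg_sq_two_mul_sqrt_log_le hp hn1 (by linarith : ((n / 2 : ℕ) : ℝ) ≤ n)
  have heven : ((n / 2 : ℕ) : ℝ) * Real.exp (-(x ^ 2 / 2)) ≤ 1 / n := by
    refine le_trans ?_ (mul_exp_neg_sq_two_mul_sqrt_log_le hs hn1
      (by linarith : ((n / 2 : ℕ) : ℝ) ≤ n))
    gcongr
    exact le_mul_of_one_le_left (Nat.cast_nonneg _) hs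
  have hinv : 0 ≤ 1 / (n : ℝ) := by positivity
  rw [show (22 : ℝ) / n = 22 * (1 / n) by ring]
  linarith

end Typical

section SignalToNoise

variable {n m κ U Θ ℓ Λ σ s : ℝ}

theorem mul_le_of_snr_le {b : ℝ} (hn : 0 < n) (hκ : 0 < κ) (hU : 0 < U)
    (h : 240 / (2 * κ / n) * √(Λ / n) * (b / U + Θ / U) ≤ 1 / 2) :
    240 * (√n * √Λ * (b + Θ)) ≤ κ * U := by
  have hsqrt : √n ^ 2 = n := Real.sq_sqrt hn.le
  have hsqrt0 : 0 < √n := Real.sqrt_pos.mpr hn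
  have hclear : 240 / (2 * κ / n) * √(Λ / n) * (b / U + Θ / U) =
      120 * (√n * √Λ * (b + Θ)) / (κ * U) := by
    rw [Real.sqrt_div' _ hn.le]
    field_simp
    rw [hsqrt]
    ring
  rw [hclear, div_le_iff₀ (by positivity)] at h
  linarith

theorem alignment_of_snr (hn : 0 ≤ n) (hmn : m ≤ n) (hℓΛ : ℓ ≤ Λ) (hΘ : 0 ≤ Θ) (hσ : 0 < σ)
    (h : 240 * (√n * √Λ * (σ * √s + Θ)) ≤ κ * U) :
    2 * (√m * (5 * (2 * √ℓ)) * Θ) + 2 * (2 * σ * √(n * Λ) * √s) ≤ U * κ / 6 := by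
  have hscale : √m * √ℓ * Θ ≤ √n * √Λ * Θ := by gcongr
  have hmean : 0 ≤ √n * √Λ * Θ := by positivity
  have hpenalty : 0 ≤ √n * √Λ * (σ * √s) := by positivity
  rw [Real.sqrt_mul hn]
  linarith

theorem peak_error_le (hU : 0 < U) (hσ : 0 < σ) :
    4 * (5 * (2 * √ℓ) * Θ + σ * (2 * √ℓ)) / U ≤ 40 * (√ℓ * (σ + Θ)) / U := by
  refine div_le_div_of_nonneg_right ?_ hU.le
  have hnoise : 0 ≤ √ℓ * σ := by positivity
  linarith

theorem peak_error_lt_of_snr (hκ : 0 < κ) (hκn : κ ≤ n) (hℓΛ : ℓ ≤ Λ) (hU : 0 < U) (hΘ : 0 ≤ Θ)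
    (hσ : 0 < σ) (hs : 1 ≤ s) (h : 240 * (√n * √Λ * (σ * √s + Θ)) ≤ κ * U) :
    40 * (√ℓ * (σ + Θ)) / U < √κ / 4 := by
  have hκ0 : 0 < √κ := Real.sqrt_pos.mpr hκ
  have hσs : σ ≤ σ * √s := le_mul_of_one_le_right hσ.le (Real.one_le_sqrt.mpr hs)
  have hmul : √κ * (240 * (√ℓ * (σ + Θ))) ≤ √κ * (√κ * U) := calc
    _ = 240 * (√κ * √ℓ * (σ + Θ)) := by ring
    _ ≤ 240 * (√n * √Λ * (σ * √s + Θ)) := by gcongr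
    _ ≤ κ * U := h
    _ = √κ * (√κ * U) := by rw [← mul_assoc, Real.mul_self_sqrt hκ.le]
  have hle := le_of_mul_le_mul_left hmul hκ0
  have hpos : 0 < √κ * U := by positivity
  rw [div_lt_iff₀ hU]
  linarith

theorem rescale_peak_error {ℓ' e z : ℝ} (hκ : 0 < κ) (hU : 0 < U) (hΘ : 0 ≤ Θ) (hσ : 0 < σ)
    (hℓ : ℓ ≤ ℓ') (h : |e - z| ≤ 4 * √κ * (40 * (√ℓ * (σ + Θ)) / U)) :
    |2 * e - 2 * z| / (2 * κ) ≤ 240 * √(ℓ' / (2 * κ)) * (σ / U + Θ / U) := by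
  have hsqrt_two : √2 ≤ 3 / 2 := Real.sqrt_le_iff.mpr (by norm_num)
  have hconst : 160 ≤ 240 / √2 := by
    rw [le_div_iff₀ (by positivity)]
    linarith
  calc |2 * e - 2 * z| / (2 * κ) = |e - z| / √κ ^ 2 := by
        rw [← mul_sub, abs_mul, abs_two, mul_div_mul_left _ _ two_ne_zero, Real.sq_sqrt hκ.le]
    _ ≤ 4 * √κ * (40 * (√ℓ' * (σ + Θ)) / U) / √κ ^ 2 := by
        gcongr
        refine h.trans ?_
        gcongr
    _ = 160 * (√ℓ' / √κ * ((σ + Θ) / U)) := by field_simp; ring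
    _ ≤ 240 / √2 * (√ℓ' / √κ * ((σ + Θ) / U)) := by gcongr
    _ = 240 * √(ℓ' / (2 * κ)) * (σ / U + Θ / U) := by
        rw [Real.sqrt_div' _ (by positivity), Real.sqrt_mul zero_le_two]
        field_simp

end SignalToNoise

section Estimator

variable {p n k z : ℕ} {μ₁ μ₂ : EuclideanSpace ℝ (Fin p)} {σ : ℝ} {q : Fin p → unitInterval}

theorem boundaryDist_eq (hn : Even n) (hz : Even z) (hzn : z < n) :
    boundaryDist n z = 2 * (min (z / 2) (n / 2 - z / 2) : ℕ) / n := by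
  obtain ⟨m, rfl⟩ := even_iff_two_dvd.mp hn
  obtain ⟨ζ, rfl⟩ := even_iff_two_dvd.mp hz
  have hζm : ζ ≤ m := by omega
  rw [boundaryDist, Nat.mul_div_cancel_left m two_pos, Nat.mul_div_cancel_left ζ two_pos]
  push_cast [Nat.cast_sub hζm]
  rw [mul_min_of_nonneg _ _ zero_le_two, mul_sub]

theorem two_mul_natCast_half (hn : Even n) : 2 * ((n / 2 : ℕ) : ℝ) = n := by
  exact_mod_cast Nat.two_mul_div_two_of_even hn

theorem natCast_mul_boundaryDist (hn : Even n) (hz : Even z) (hzn : z < n) :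
    n * boundaryDist n z = 2 * (min (z / 2) (n / 2 - z / 2) : ℕ) := by
  have hn0 : (n : ℝ) ≠ 0 := by exact_mod_cast (by omega : n ≠ 0)
  rw [boundaryDist_eq hn hz hzn, mul_div_cancel₀ _ hn0]

theorem log_natCast_mul_le {a b : ℕ} (ha : 0 < a) (hn : 0 < n) (hab : a ≤ b) :
    Real.log (a * n) ≤ Real.log (b * n) := by
  gcongr

theorem mul_le_min_mul_weightedNorm_of_snr_le (hn : Even n) (hz : Even z) (hz1 : 1 ≤ z)
    (hzn : z < n) (hσ : 0 < σ)
    (hU : 0 < weightedNorm q (μ₂ - μ₁)) (hk : sparsity (μ₂ - μ₁) ≤ k)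
    (h : 240 / boundaryDist n z * √(Real.log (p * n) / n) *
      (σ * √k / weightedNorm q (μ₂ - μ₁) + ‖μ₂ - μ₁‖ / weightedNorm q (μ₂ - μ₁)) ≤ 1 / 2) :
    240 * (√n * √(Real.log (p * n)) * (σ * √(sparsity (μ₂ - μ₁)) + ‖μ₂ - μ₁‖)) ≤
      (min (z / 2) (n / 2 - z / 2) : ℕ) * weightedNorm q (μ₂ - μ₁) := by
  have hn0 : (0 : ℝ) < n := by exact_mod_cast (by omega : 0 < n)
  have hκ : (0 : ℝ) < (min (z / 2) (n / 2 - z / 2) : ℕ) := by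
    obtain ⟨ζ, rfl⟩ := even_iff_two_dvd.mp hz
    obtain ⟨m, rfl⟩ := even_iff_two_dvd.mp hn
    exact_mod_cast (by omega : 0 < min (2 * ζ / 2) (2 * m / 2 - 2 * ζ / 2))
  rw [boundaryDist_eq hn hz hzn] at h
  refine le_trans ?_ (mul_le_of_snr_le hn0 hκ hU h)
  gcongr

theorem abs_splitEstimator_sub_le
    {opt : (Fin p → Fin (n / 2 - 1) → ℝ) →
      EuclideanSpace ℝ (Fin p) × EuclideanSpace ℝ (Fin (n / 2 - 1))}
    {d : (Fin p → Fin n → ℝ) × (Fin p → Fin n → Bool)}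
    (hn : Even n) (hz : Even z) (hz1 : 1 ≤ z) (hzn : z < n) (hθ : μ₂ - μ₁ ≠ 0)
    (hk : sparsity (μ₂ - μ₁) ≤ k) (hσ : 0 < σ) (hq : ∀ j, 0 < q j)
    (hopt : ∀ T, opt T ∈ argmaxSet (2 * σ * √(n * Real.log (p * n))) T)
    (hsnr : 240 / boundaryDist n z * √(Real.log (p * n) / n) *
      (σ * √k / weightedNorm q (μ₂ - μ₁) + ‖μ₂ - μ₁‖ / weightedNorm q (μ₂ - μ₁)) ≤ 1 / 2)
    (hd : splitColumns d ∈ typicalSamples n z μ₁ μ₂ σ q fun T => (opt T).1) :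
    |splitEstimator opt (mask d.1 d.2) d.2 - z| / (n * boundaryDist n z) ≤
      240 * √(Real.log (k * n) / (n * boundaryDist n z)) *
        (σ / weightedNorm q (μ₂ - μ₁) + ‖μ₂ - μ₁‖ / weightedNorm q (μ₂ - μ₁)) := by
  have hU := weightedNorm_pos hq hθ
  have hsnr' := mul_le_min_mul_weightedNorm_of_snr_le hn hz hz1 hzn hσ hU hk hsnr
  have hn0 : 0 < n := by omega
  have hs := sparsity_pos hθ
  have hℓΛ := log_natCast_mul_le hs hn0 (sparsity_le (μ₂ - μ₁))
  have hz0 : 0 < z / 2 := Nat.div_pos (by have := hz.two_dvd; omega) two_pos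
  have hzm : z / 2 < n / 2 := by have := hz.two_dvd; have := hn.two_dvd; omega
  have hκ : (0 : ℝ) < (min (z / 2) (n / 2 - z / 2) : ℕ) := by
    exact_mod_cast lt_min hz0 (Nat.sub_pos_of_lt hzm)
  have hκn : ((min (z / 2) (n / 2 - z / 2) : ℕ) : ℝ) ≤ n := by exact_mod_cast (by omega)
  have hmn : ((n / 2 : ℕ) : ℝ) ≤ n := by exact_mod_cast Nat.div_le_self n 2
  have hlam : √(n / 2 : ℕ) * (σ * (2 * √(Real.log (p * n)))) ≤
      2 * σ * √(n * Real.log (p * n)) := by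
    rw [Real.sqrt_mul (Nat.cast_nonneg n), mul_left_comm, mul_left_comm _ 2, ← mul_assoc σ,
      mul_comm σ 2]
    gcongr
  have herror := (IsRegular.abs_estimate_sub_le hd hz0 hzm hopt (by positivity) (by positivity)
    hlam hU (alignment_of_snr (Nat.cast_nonneg n) hmn hℓΛ (norm_nonneg _) hσ hsnr')
    ((peak_error_le hU hσ).trans_lt
      (peak_error_lt_of_snr hκ hκn hℓΛ hU (norm_nonneg _) hσ (by exact_mod_cast hs) hsnr'))).trans
    (mul_le_mul_of_nonneg_left (peak_error_le hU hσ) (by positivity))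
  have hrescaled := rescale_peak_error hκ hU (norm_nonneg _) hσ (log_natCast_mul_le hs hn0 hk)
    herror
  rwa [two_mul_natCast_half hz, ← natCast_mul_boundaryDist hn hz hzn] at hrescaled

end Estimator

end MissInspect

open MissInspect in
theorem theorem1 :
    ∃ C : ℝ, 0 < C ∧ ∃ C' : ℝ, 0 < C' ∧
      ∀ (n p k z : ℕ) (μ₁ μ₂ θ : EuclideanSpace ℝ (Fin p)) (σ : ℝ) (q : Fin p → unitInterval)
        (opt : (Fin p → Fin (n / 2 - 1) → ℝ) →
          EuclideanSpace ℝ (Fin p) × EuclideanSpace ℝ (Fin (n / 2 - 1))),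
        Even n → Even z → 1 ≤ z → z < n →
        θ = μ₂ - μ₁ → θ ≠ 0 → MissInspect.sparsity θ ≤ k →
        0 < σ → (∀ j, 0 < q j) →
        (∀ T, opt T ∈ MissInspect.argmaxSet
          (2 * σ * Real.sqrt (n * Real.log (p * n))) T) →
        Measurable (fun T => (opt T).1) →
        C' / MissInspect.boundaryDist n z * Real.sqrt (Real.log (p * n) / n) *
            (σ * Real.sqrt k / MissInspect.weightedNorm q θ +
              ‖θ‖ / MissInspect.weightedNorm q θ) ≤ 1 / 2 →
        MissInspect.changepointLaw n z μ₁ μ₂ σ q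
            {d | C * Real.sqrt (Real.log (k * n) / (n * MissInspect.boundaryDist n z)) *
                  (σ / MissInspect.weightedNorm q θ + ‖θ‖ / MissInspect.weightedNorm q θ) <
                |MissInspect.splitEstimator opt (MissInspect.mask d.1 d.2) d.2 - z| /
                  (n * MissInspect.boundaryDist n z)} ≤
          ENNReal.ofReal (22 / n) := by
  refine ⟨240, by norm_num, 240, by norm_num, ?_⟩
  intro n p k z μ₁ μ₂ θ σ q opt hn hz hz1 hzn hθ_eq hθ hk hσ hq hopt hmeas hsnr
  subst hθ_eq
  have hopt_norm (T) : ‖(opt T).1‖ ≤ 1 := mem_closedBall_zero_iff.mp (hopt T).1.1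
  calc _ ≤ changepointLaw n z μ₁ μ₂ σ q
        (splitColumns ⁻¹' (typicalSamples n z μ₁ μ₂ σ q fun T => (opt T).1)ᶜ) :=
        measure_mono fun _ hfar htypical => not_lt_of_ge
          (abs_splitEstimator_sub_le hn hz hz1 hzn hθ hk hσ hq hopt hsnr htypical) hfar
    _ ≤ splitLaw (n / 2) (z / 2) μ₁ μ₂ σ q
        (typicalSamples n z μ₁ μ₂ σ q fun T => (opt T).1)ᶜ :=
        (measurePreserving_splitColumns hn hz μ₁ μ₂ σ q).measure_preimage_le _
    _ ≤ ENNReal.ofReal (22 / n) :=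
        splitLaw_compl_typicalSamples_le (by omega) hσ hθ hmeas hopt_norm
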